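/- All graphs are finite and simple. For a graph $G$ let $\operatorname{Mad}(G)=\max_{H}\frac{2|E(H)|}{|V(H)|}$, the maximum being over all subgraphs $H$ of $G$ with at least one vertex, be its maximum average degree. An \emph{I,F-partition} of $G$ is a partition $V(G)=\mathcal I\sqcup\mathcal F$ (parts may be empty) such that the vertices of $\mathcal I$ have pairwise distance greater than $2$ in $G$ (that is, $\mathcal I$ is a 2-independent set) and $G[\mathcal F]$ is a forest. Theorem. Every graph $G$ with $\operatorname{Mad}(G)<\frac52$ has an I,F-partition. This is sharp: there is a graph $G$ with $\operatorname{Mad}(G)=\frac52$ that has no I,F-partition. Consequently $\frac52$ is the largest real number $b$ such that every graph $G$ with $\operatorname{Mad}(G)<b$ has an I,F-partition, which answers a question of Cranston and West. -/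

import Mathlib

universe u

/-- The maximum average degree of a finite graph: the largest value of `2|E(H)| / |V(H)|` over the
subgraphs `H` with at least one vertex. (The set of these values is finite, so that the supremum
is a maximum as soon as the graph has a vertex; it is `0` for the graph without vertices.) -/
noncomputable def SimpleGraph.maxAvgDegree {V : Type u} (G : SimpleGraph V) : ℝ :=
  sSup {d : ℝ | ∃ H : G.Subgraph, H.verts.Nonempty ∧
    d = 2 * (H.edgeSet.ncard : ℝ) / (H.verts.ncard : ℝ)}

/-- A set of vertices is 2-independent if its vertices have pairwise distance greater than 2.
The extended distance is used: it is infinite between different components. -/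
def SimpleGraph.IsTwoIndependent {V : Type u} (G : SimpleGraph V) (S : Set V) : Prop :=
  S.Pairwise fun x y => 2 < G.edist x y

/-- `(I, F)` is an I,F-partition: the vertex set is the disjoint union of `I` and `F` (either may be
empty), `I` is 2-independent in `G`, and `F` induces a forest. -/
def SimpleGraph.IsIFPartition {V : Type u} (G : SimpleGraph V) (I F : Set V) : Prop :=
  I ∪ F = Set.univ ∧ Disjoint I F ∧ G.IsTwoIndependent I ∧ (G.induce F).IsAcyclic

/-- The graph has an I,F-partition. -/
def SimpleGraph.HasIFPartition {V : Type u} (G : SimpleGraph V) : Prop :=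
  ∃ I F : Set V, G.IsIFPartition I F

/-!
# I,F-partitions of graphs with maximum average degree less than 5/2

The upper bound is proved by induction for graphs whose vertices carry labels: `free` (weight 5),
`forest` (weight 4, forced into the forest part) and `guarded` (weight 2, forced into the forest
part and without neighbours in the independent part). The potential of a vertex set is the sum of
its weights minus 4 for each induced edge. If all vertices are free, `Mad(G) < 5/2` says that every
nonempty set has positive potential, and the claim (`IsSparse.exists_coloring`) is that every
labelled graph with this property has an I,F-partition that respects the labels.

In a counterexample with the fewest vertices, every proper subset `W` with at least two vertices has
potential at least 3 (`IsMinimal.three_le_potential`): otherwise color `W`, shrink its forest part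
to one guarded vertex, turn the neighbours of its independent part into guarded vertices, and color
the resulting smaller graph. The weights are chosen such that this keeps all potentials positive,
apart from one case in which `W` hangs on a bridge. This gap gives room for reductions in which a
few vertices are deleted or contracted and some of the remaining vertices are forced into the forest
part. They show that all degrees are at least 2, that forest vertices have degree at least 3, that
there is no path of three free vertices of degree two (`IsMinimal.not_isTwo_path`), and that there
are not too many free vertices of degree two around a vertex (`IsMinimal.not_forall_isTwo`,
`IsMinimal.not_path_and_two`, `IsMinimal.not_two_paths_and_two`).

Give each vertex the charge "weight minus twice the degree"; the total is the potential of the whole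
graph, which is positive. Only free vertices of degree two have positive charge, namely 1, and the
reductions show that they can pass it on to the other vertices without making any of those positive
(`IsMinimal.demand_mul_degIn`, `IsMinimal.sum_demand_le`), a contradiction.

For sharpness, attach a triangle by an edge to each vertex of a central triangle (`sharpGraph`). One
of the central vertices has to be in the independent part, and then the triangle attached to it lies
in the forest part.
-/

namespace IFPartition

open Finset
open scoped Classical

/-! ### Degrees, labels and potentials -/

section

variable {V : Type*}

/-- The number of neighbours of `x` in `S`. -/
noncomputable def degIn (G : SimpleGraph V) (x : V) (S : Finset V) : ℕ :=
  #{y ∈ S | G.Adj x y}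

/-- Twice the number of edges of `G` with both ends in `S`. -/
noncomputable def degSum (G : SimpleGraph V) (S : Finset V) : ℕ :=
  ∑ x ∈ S, degIn G x S

lemma degIn_eq_sum (G : SimpleGraph V) (x : V) (S : Finset V) :
    degIn G x S = ∑ y ∈ S, if G.Adj x y then 1 else 0 := by
  simp [degIn]

lemma sum_degIn_comm (G : SimpleGraph V) (S T : Finset V) :
    ∑ x ∈ S, degIn G x T = ∑ y ∈ T, degIn G y S := by
  simp only [degIn_eq_sum]
  rw [sum_comm]
  simp only [G.adj_comm]

lemma degIn_union (G : SimpleGraph V) (x : V) {S T : Finset V} (h : Disjoint S T) :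
    degIn G x (S ∪ T) = degIn G x S + degIn G x T := by
  simp only [degIn_eq_sum, sum_union h]

lemma degIn_mono (G : SimpleGraph V) (x : V) {S T : Finset V} (h : S ⊆ T) :
    degIn G x S ≤ degIn G x T :=
  card_le_card (filter_subset_filter _ h)

lemma degIn_pos {G : SimpleGraph V} {x y : V} {S : Finset V} (hy : y ∈ S) (h : G.Adj x y) :
    1 ≤ degIn G x S :=
  card_pos.2 ⟨y, by simp [hy, h]⟩

lemma degIn_eq_zero {G : SimpleGraph V} {x : V} {S : Finset V} :
    degIn G x S = 0 ↔ ∀ y ∈ S, ¬ G.Adj x y := by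
  simp [degIn, filter_eq_empty_iff]

lemma two_le_degIn {G : SimpleGraph V} {x y z : V} {S : Finset V} (hy : y ∈ S) (hz : z ∈ S)
    (hyz : y ≠ z) (h : G.Adj x y) (h' : G.Adj x z) : 2 ≤ degIn G x S := by
  rw [← card_pair hyz]
  exact card_le_card (by intro u; simp; rintro (rfl | rfl) <;> simp [*])

lemma degIn_le_one {G : SimpleGraph V} {x p : V} {S : Finset V}
    (h : ∀ u ∈ S, G.Adj x u → u = p) : degIn G x S ≤ 1 :=
  card_le_one.2 (by
    intro a ha b hb
    simp only [mem_filter] at ha hb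
    rw [h a ha.1 ha.2, h b hb.1 hb.2])

lemma degSum_union (G : SimpleGraph V) {S T : Finset V} (h : Disjoint S T) :
    degSum G (S ∪ T) = degSum G S + degSum G T + 2 * ∑ x ∈ S, degIn G x T := by
  simp only [degSum, sum_union h, degIn_union G _ h, sum_add_distrib]
  rw [sum_degIn_comm G T S]
  ring

lemma degSum_insert (G : SimpleGraph V) {v : V} {S : Finset V} (hv : v ∉ S) :
    degSum G (insert v S) = degSum G S + 2 * degIn G v S := by
  rw [insert_eq, degSum_union G (by simpa using hv)]
  simp [degSum, degIn]

lemma degSum_mono_graph {G G' : SimpleGraph V} {S : Finset V}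
    (h : ∀ x ∈ S, ∀ y ∈ S, G.Adj x y → G'.Adj x y) : degSum G S ≤ degSum G' S :=
  sum_le_sum fun x hx => card_le_card fun y => by
    simp only [mem_filter]
    exact fun hy => ⟨hy.1, h x hx y hy.1 hy.2⟩

lemma degSum_congr {G G' : SimpleGraph V} {S : Finset V}
    (h : ∀ x ∈ S, ∀ y ∈ S, (G.Adj x y ↔ G'.Adj x y)) : degSum G S = degSum G' S :=
  le_antisymm (degSum_mono_graph fun x hx y hy => (h x hx y hy).1)
    (degSum_mono_graph fun x hx y hy => (h x hx y hy).2)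

/-- The state of a vertex in a partially coloured graph: a `free` vertex may go to either part,
a `forest` vertex has to go to the forest, and a `guarded` vertex has to go to the forest and must
not have a neighbour in the independent part (it behaves as if it already had one). -/
inductive Label
  | free
  | forest
  | guarded

/-- The weight of a vertex in the potential. -/
def Label.weight : Label → ℤ
  | free => 5
  | forest => 4
  | guarded => 2

lemma Label.weight_le (l : Label) : l.weight ≤ 5 := by cases l <;> simp [weight]

lemma Label.two_le_weight (l : Label) : 2 ≤ l.weight := by cases l <;> simp [weight]

/-- The potential of a vertex set: the weights of its vertices, minus 4 for each induced edge. -/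
noncomputable def potential (G : SimpleGraph V) (ℓ : V → Label) (S : Finset V) : ℤ :=
  ∑ x ∈ S, (ℓ x).weight - 2 * degSum G S

lemma potential_union (G : SimpleGraph V) (ℓ : V → Label) {S T : Finset V} (h : Disjoint S T) :
    potential G ℓ (S ∪ T) =
      potential G ℓ S + potential G ℓ T - 4 * ∑ x ∈ S, (degIn G x T : ℤ) := by
  simp only [potential, sum_union h, degSum_union G h]
  push_cast
  ring

lemma potential_insert (G : SimpleGraph V) (ℓ : V → Label) {v : V} {S : Finset V} (hv : v ∉ S) :
    potential G ℓ (insert v S) = potential G ℓ S + (ℓ v).weight - 4 * degIn G v S := by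
  simp only [potential, sum_insert hv, degSum_insert G hv]
  push_cast
  ring

lemma potential_insert_le_one {G : SimpleGraph V} {ℓ : V → Label} {v p : V} {S : Finset V}
    (hv : v ∉ S) (hp : p ∈ S) (h : G.Adj v p) :
    potential G ℓ (insert v S) ≤ potential G ℓ S + (ℓ v).weight - 4 := by
  have := degIn_pos hp h
  rw [potential_insert G ℓ hv]
  omega

lemma potential_insert_le_two {G : SimpleGraph V} {ℓ : V → Label} {v p q : V} {S : Finset V}
    (hv : v ∉ S) (hp : p ∈ S) (hq : q ∈ S) (hpq : p ≠ q) (h : G.Adj v p) (h' : G.Adj v q) :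
    potential G ℓ (insert v S) ≤ potential G ℓ S + (ℓ v).weight - 8 := by
  have := two_le_degIn hp hq hpq h h'
  rw [potential_insert G ℓ hv]
  omega

lemma potential_singleton (G : SimpleGraph V) (ℓ : V → Label) (v : V) :
    potential G ℓ {v} = (ℓ v).weight := by
  simp [potential, degSum, degIn]

lemma potential_update_of_notMem (G : SimpleGraph V) (ℓ : V → Label) {v : V} {S : Finset V}
    (hv : v ∉ S) (l : Label) :
    potential G (Function.update ℓ v l) S = potential G ℓ S := by
  unfold potential
  congr 1
  refine sum_congr rfl fun x hx => ?_
  rw [Function.update_of_ne (by rintro rfl; exact hv hx)]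

lemma potential_update_of_mem (G : SimpleGraph V) (ℓ : V → Label) {v : V} {S : Finset V}
    (hv : v ∈ S) (l : Label) :
    potential G (Function.update ℓ v l) S = potential G ℓ S - (ℓ v).weight + l.weight := by
  unfold potential
  rw [← insert_erase hv, sum_insert (by simp), sum_insert (by simp)]
  have : ∑ x ∈ S.erase v, (Function.update ℓ v l x).weight = ∑ x ∈ S.erase v, (ℓ x).weight :=
    sum_congr rfl fun x hx => by rw [Function.update_of_ne (by simp at hx; exact hx.1)]
  rw [this]
  simp
  ring

lemma potential_sup_edge_of_notMem (G : SimpleGraph V) (ℓ : V → Label) {a b : V} {S : Finset V}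
    (h : a ∉ S ∨ b ∉ S) :
    potential (G ⊔ SimpleGraph.edge a b) ℓ S = potential G ℓ S := by
  unfold potential
  rw [degSum_congr]
  intro x hx y hy
  simp only [SimpleGraph.sup_adj, SimpleGraph.edge_adj]
  constructor
  · rintro (h' | ⟨⟨rfl, rfl⟩ | ⟨rfl, rfl⟩, -⟩) <;> simp_all
  · exact Or.inl

lemma degSum_sup_edge (G : SimpleGraph V) {a b : V} {S : Finset V} (ha : a ∈ S) (hb : b ∈ S)
    (hab : a ≠ b) (h : ¬ G.Adj a b) :
    degSum (G ⊔ SimpleGraph.edge a b) S = degSum G S + 2 := by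
  obtain ⟨T, hT, rfl⟩ : ∃ T, a ∉ T ∧ S = insert a T := ⟨S.erase a, by simp, by simp [ha]⟩
  have hbT : b ∈ T := by simpa [hab.symm] using hb
  rw [degSum_insert _ hT, degSum_insert _ hT]
  have h1 : degSum (G ⊔ SimpleGraph.edge a b) T = degSum G T := by
    refine degSum_congr ?_
    intro x hx y hy
    simp only [SimpleGraph.sup_adj, SimpleGraph.edge_adj]
    constructor
    · rintro (h' | ⟨⟨rfl, rfl⟩ | ⟨rfl, rfl⟩, -⟩) <;> simp_all
    · exact Or.inl
  have h2 : degIn (G ⊔ SimpleGraph.edge a b) a T = degIn G a T + 1 := by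
    have : degIn (G ⊔ SimpleGraph.edge a b) a T = #(insert b {y ∈ T | G.Adj a y}) := by
      unfold degIn
      congr 1
      ext y
      simp only [SimpleGraph.sup_adj, SimpleGraph.edge_adj, mem_filter, mem_insert]
      constructor
      · rintro ⟨hy, h' | ⟨⟨-, rfl⟩ | ⟨rfl, rfl⟩, -⟩⟩ <;> simp_all
      · rintro (rfl | h')
        · exact ⟨hbT, Or.inr ⟨Or.inl (by simp), hab⟩⟩
        · exact ⟨h'.1, Or.inl h'.2⟩
    rw [this, card_insert_of_notMem (by simp [h]), degIn]
  rw [h1, h2]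
  ring

lemma potential_sup_edge (G : SimpleGraph V) (ℓ : V → Label) {a b : V} {S : Finset V}
    (ha : a ∈ S) (hb : b ∈ S) (hab : a ≠ b) (h : ¬ G.Adj a b) :
    potential (G ⊔ SimpleGraph.edge a b) ℓ S = potential G ℓ S - 4 := by
  unfold potential
  rw [degSum_sup_edge G ha hb hab h]
  push_cast
  ring

end

/-! ### Forests and colorings -/

section

variable {V : Type*}

/-- `F` induces a forest, in the counting form: every nonempty `T ⊆ F` induces at most `|T| - 1`
edges. -/
def IsForest (G : SimpleGraph V) (F : Finset V) : Prop :=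
  ∀ T ⊆ F, T.Nonempty → degSum G T + 2 ≤ 2 * #T

/-- The counting form of "`p` and `q` lie in different components of the forest induced by `F`":
vacuous if `p` or `q` is not in `F`, and false if `p = q ∈ F`. -/
def IsSeparated (G : SimpleGraph V) (F : Finset V) (p q : V) : Prop :=
  ∀ T ⊆ F, p ∈ T → q ∈ T → degSum G T + 4 ≤ 2 * #T

variable {G G' : SimpleGraph V} {F A B I : Finset V} {ℓ ℓ' : V → Label} {p q v : V}

lemma IsForest.mono (h : IsForest G F) {F' : Finset V} (hF : F' ⊆ F) : IsForest G F' :=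
  fun T hT hne => h T (hT.trans hF) hne

lemma IsForest.anti (h : IsForest G' F) (hG : ∀ x ∈ F, ∀ y ∈ F, G.Adj x y → G'.Adj x y) :
    IsForest G F := fun T hT hne =>
  (Nat.add_le_add_right (degSum_mono_graph fun x hx y hy => hG x (hT hx) y (hT hy)) 2).trans
    (h T hT hne)

lemma IsSeparated.of_notMem_left (h : p ∉ F) : IsSeparated G F p q :=
  fun _ hT hp _ => absurd (hT hp) h

lemma IsSeparated.of_notMem_right (h : q ∉ F) : IsSeparated G F p q :=
  fun _ hT _ hq => absurd (hT hq) h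

lemma IsSeparated.symm (h : IsSeparated G F p q) : IsSeparated G F q p :=
  fun T hT hq hp => h T hT hp hq

/-- A forest stays a forest if a vertex with at most two neighbours is added, provided these lie in
different components. -/
lemma IsForest.insert (h : IsForest G F) (hv : v ∉ F)
    (hN : ∀ u ∈ F, G.Adj v u → u = p ∨ u = q) (hpq : IsSeparated G F p q) :
    IsForest G (insert v F) := by
  intro T hT hne
  by_cases hvT : v ∈ T
  · obtain ⟨S, hS, rfl⟩ : ∃ S, v ∉ S ∧ T = Insert.insert v S :=
      ⟨T.erase v, by simp, by simp [hvT]⟩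
    have hSF : S ⊆ F := by
      intro x hx
      have := hT (mem_insert_of_mem hx)
      rcases mem_insert.1 this with rfl | h'
      · exact absurd hx hS
      · exact h'
    rw [degSum_insert G hS, card_insert_of_notMem hS]
    by_cases hmem : p ∈ S ∧ q ∈ S
    · have h1 := hpq S hSF hmem.1 hmem.2
      have h2 : degIn G v S ≤ 2 :=
        (card_le_card (t := {p, q}) (by
          intro u
          simp only [mem_filter, mem_insert, mem_singleton]
          exact fun hu => hN u (hSF hu.1) hu.2)).trans card_le_two
      omega
    · rcases S.eq_empty_or_nonempty with rfl | hSne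
      · simp [degSum, degIn]
      · have h1 := h S hSF hSne
        have h2 : degIn G v S ≤ 1 := by
          by_cases hp : p ∈ S
          · refine degIn_le_one (p := p) fun u hu hvu => ?_
            rcases hN u (hSF hu) hvu with rfl | rfl
            · rfl
            · exact absurd ⟨hp, hu⟩ hmem
          · refine degIn_le_one (p := q) fun u hu hvu => ?_
            rcases hN u (hSF hu) hvu with rfl | rfl
            · exact absurd hu hp
            · rfl
        omega
  · refine h T (fun x hx => ?_) hne
    rcases mem_insert.1 (hT hx) with rfl | h'
    · exact absurd hx hvT
    · exact h'

/-- A leaf `v` attached at `p` is separated from whatever `p` is separated from. -/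
lemma IsSeparated.insert (h : IsSeparated G F p q) (hF : IsForest G F) (hv : v ∉ F) (hqv : q ≠ v)
    (hN : ∀ u ∈ F, G.Adj v u → u = p) : IsSeparated G (insert v F) v q := by
  intro T hT hvT hqT
  obtain ⟨S, hS, rfl⟩ : ∃ S, v ∉ S ∧ T = Insert.insert v S :=
    ⟨T.erase v, by simp, by simp [hvT]⟩
  have hSF : S ⊆ F := by
    intro x hx
    rcases mem_insert.1 (hT (mem_insert_of_mem hx)) with rfl | h'
    · exact absurd hx hS
    · exact h'
  have hqS : q ∈ S := by simpa [hqv] using hqT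
  rw [degSum_insert G hS, card_insert_of_notMem hS]
  by_cases hp : p ∈ S
  · have h1 := h S hSF hp hqS
    have h2 : degIn G v S ≤ 1 := degIn_le_one fun u hu => hN u (hSF hu)
    omega
  · have h1 := hF S hSF ⟨q, hqS⟩
    have h2 : degIn G v S = 0 := degIn_eq_zero.2 fun u hu hvu => by
      rw [hN u (hSF hu) hvu] at hu
      exact hp hu
    omega

/-- If adding the edge `pq` keeps the forest a forest, then `p` and `q` are separated. -/
lemma IsForest.isSeparated (h : IsForest (G ⊔ SimpleGraph.edge p q) F) (hpq : p ≠ q)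
    (hadj : ¬ G.Adj p q) : IsSeparated G F p q := by
  intro T hT hp hq
  have := h T hT ⟨p, hp⟩
  rw [degSum_sup_edge G hp hq hpq hadj] at this
  omega

/-- `I` is the independent part of an I,F-partition of the subgraph induced by `A` that respects
the labels. That two vertices of `I` have distance more than 2 is expressed by `indep` and
`unique`. -/
structure IsColoring (G : SimpleGraph V) (ℓ : V → Label) (A I : Finset V) : Prop where
  subset : I ⊆ A
  free : ∀ i ∈ I, ℓ i = Label.free
  indep : ∀ i ∈ I, ∀ j ∈ I, ¬ G.Adj i j
  unique : ∀ v ∈ A, ∀ i ∈ I, ∀ j ∈ I, G.Adj v i → G.Adj v j → i = j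
  guarded : ∀ v ∈ A, ℓ v = Label.guarded → ∀ i ∈ I, ¬ G.Adj v i
  forest : IsForest G (A \ I)

lemma IsColoring.restrict (h : IsColoring G ℓ A I) (hB : B ⊆ A) :
    IsColoring G ℓ B (I ∩ B) where
  subset := inter_subset_right
  free i hi := h.free i (mem_inter.1 hi).1
  indep i hi j hj := h.indep i (mem_inter.1 hi).1 j (mem_inter.1 hj).1
  unique v hv i hi j hj := h.unique v (hB hv) i (mem_inter.1 hi).1 j (mem_inter.1 hj).1
  guarded v hv hl i hi := h.guarded v (hB hv) hl i (mem_inter.1 hi).1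
  forest := h.forest.mono fun x hx => by
    simp only [mem_sdiff, mem_inter] at hx ⊢
    exact ⟨hB hx.1, fun hI => hx.2 ⟨hI, hx.1⟩⟩

lemma IsColoring.restrict_erase (h : IsColoring G ℓ A I) :
    IsColoring G ℓ (A.erase v) (I.erase v) := by
  have := h.restrict (erase_subset v A)
  have e : I ∩ A.erase v = I.erase v := by
    ext x
    have := @h.subset x
    simp only [mem_inter, mem_erase]
    tauto
  rwa [e] at this

/-- A coloring for more edges and stronger labels. -/
lemma IsColoring.weaken (h : IsColoring G' ℓ' A I)
    (hG : ∀ x ∈ A, ∀ y ∈ A, G.Adj x y → G'.Adj x y)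
    (hfree : ∀ x ∈ A, ℓ' x = Label.free → ℓ x = Label.free)
    (hguarded : ∀ x ∈ A, ℓ x = Label.guarded → ℓ' x = Label.guarded) :
    IsColoring G ℓ A I where
  subset := h.subset
  free i hi := hfree i (h.subset hi) (h.free i hi)
  indep i hi j hj hij := h.indep i hi j hj (hG i (h.subset hi) j (h.subset hj) hij)
  unique v hv i hi j hj hvi hvj := h.unique v hv i hi j hj (hG v hv i (h.subset hi) hvi)
    (hG v hv j (h.subset hj) hvj)
  guarded v hv hl i hi hvi := h.guarded v hv (hguarded v hv hl) i hi (hG v hv i (h.subset hi) hvi)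
  forest := h.forest.anti fun x hx y hy => hG x (mem_sdiff.1 hx).1 y (mem_sdiff.1 hy).1

/-- Extend a coloring by a vertex in the forest part. A vertex with a single coloured neighbour
`p` is the case `q = v`. -/
lemma IsColoring.insert_forest (h : IsColoring G ℓ B I) (hv : v ∉ B)
    (hl : ℓ v = Label.guarded → ∀ i ∈ I, ¬ G.Adj v i)
    (hN : ∀ u ∈ B, G.Adj v u → u = p ∨ u = q) (hI : ¬ (p ∈ I ∧ q ∈ I))
    (hsep : IsSeparated G (B \ I) p q) : IsColoring G ℓ (insert v B) I where
  subset := h.subset.trans (subset_insert _ _)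
  free := h.free
  indep := h.indep
  unique u hu i hi j hj hui huj := by
    rcases mem_insert.1 hu with rfl | hu
    · rcases hN i (h.subset hi) hui with rfl | rfl <;>
      rcases hN j (h.subset hj) huj with rfl | rfl
      · rfl
      · exact absurd ⟨hi, hj⟩ hI
      · exact absurd ⟨hj, hi⟩ hI
      · rfl
    · exact h.unique u hu i hi j hj hui huj
  guarded u hu hlu i hi := by
    rcases mem_insert.1 hu with rfl | hu
    · exact hl hlu i hi
    · exact h.guarded u hu hlu i hi
  forest := by
    have hvI : v ∉ I := fun hI => hv (h.subset hI)
    rw [insert_sdiff_of_notMem _ hvI]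
    exact h.forest.insert (by simp [hv]) (fun u hu => hN u (mem_sdiff.1 hu).1) hsep

/-- Extend a coloring by a free vertex in the independent part. -/
lemma IsColoring.insert_indep (h : IsColoring G ℓ B I) (hv : v ∉ B) (hl : ℓ v = Label.free)
    (hN : ∀ u ∈ B, G.Adj v u → u ∉ I ∧ ℓ u ≠ Label.guarded ∧ ∀ i ∈ I, ¬ G.Adj u i) :
    IsColoring G ℓ (insert v B) (insert v I) where
  subset := insert_subset_insert _ h.subset
  free i hi := by
    rcases mem_insert.1 hi with rfl | hi
    · exact hl
    · exact h.free i hi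
  indep i hi j hj hij := by
    rcases mem_insert.1 hi with rfl | hi' <;> rcases mem_insert.1 hj with rfl | hj'
    · exact G.loopless.irrefl _ hij
    · exact (hN j (h.subset hj') hij).1 hj'
    · exact (hN i (h.subset hi') hij.symm).1 hi'
    · exact h.indep i hi' j hj' hij
  unique u hu i hi j hj hui huj := by
    rcases mem_insert.1 hi with rfl | hi' <;> rcases mem_insert.1 hj with rfl | hj'
    · rfl
    · rcases mem_insert.1 hu with rfl | hu'
      · exact absurd hui (G.loopless.irrefl _)
      · exact absurd huj ((hN u hu' hui.symm).2.2 j hj')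
    · rcases mem_insert.1 hu with rfl | hu'
      · exact absurd huj (G.loopless.irrefl _)
      · exact absurd hui ((hN u hu' huj.symm).2.2 i hi')
    · rcases mem_insert.1 hu with rfl | hu'
      · exact absurd hi' (hN i (h.subset hi') hui).1
      · exact h.unique u hu' i hi' j hj' hui huj
  guarded u hu hlu i hi hui := by
    rcases mem_insert.1 hu with rfl | hu'
    · rw [hl] at hlu; cases hlu
    · rcases mem_insert.1 hi with rfl | hi'
      · exact (hN u hu' hui.symm).2.1 hlu
      · exact h.guarded u hu' hlu i hi' hui
  forest := h.forest.mono fun x hx => by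
    simp only [mem_sdiff, mem_insert] at hx ⊢
    tauto

/-- The labels after forcing the free vertices of `Y` into the forest part. -/
noncomputable def forced (ℓ : V → Label) (Y : Finset V) : V → Label :=
  fun x => if x ∈ Y ∧ ℓ x = Label.free then Label.forest else ℓ x

/-- Each forced free vertex costs 1. -/
lemma potential_forced (G : SimpleGraph V) (ℓ : V → Label) (Y S : Finset V) :
    potential G (forced ℓ Y) S = potential G ℓ S - #{x ∈ S | x ∈ Y ∧ ℓ x = Label.free} := by
  have : ∀ x, (forced ℓ Y x).weight =
      (ℓ x).weight - if x ∈ Y ∧ ℓ x = Label.free then 1 else 0 := by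
    intro x
    unfold forced
    split_ifs with h
    · rw [h.2]; rfl
    · simp
  simp only [potential, this, sum_sub_distrib, sum_boole]
  ring

lemma potential_sub_le_forced (G : SimpleGraph V) (ℓ : V → Label) (Y S : Finset V) :
    potential G ℓ S - #(S ∩ Y) ≤ potential G (forced ℓ Y) S := by
  rw [potential_forced]
  have : #{x ∈ S | x ∈ Y ∧ ℓ x = Label.free} ≤ #(S ∩ Y) :=
    card_le_card fun x hx => by
      simp only [mem_filter, mem_inter] at hx ⊢
      exact ⟨hx.1, hx.2.1⟩
  omega

lemma IsColoring.of_forced {Y : Finset V} (h : IsColoring G (forced ℓ Y) A I) :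
    IsColoring G ℓ A I ∧ ∀ y ∈ Y, y ∉ I := by
  have key : ∀ x, forced ℓ Y x = Label.free → ℓ x = Label.free ∧ x ∉ Y := by
    intro x hx
    unfold forced at hx
    split_ifs at hx with hc
    exact ⟨hx, fun hY => hc ⟨hY, hx⟩⟩
  refine ⟨h.weaken (fun _ _ _ _ h => h) (fun x _ hx => (key x hx).1) fun x _ hx => ?_,
    fun y hy hyI => (key y (h.free y hyI)).2 hy⟩
  unfold forced
  rw [if_neg (by simp [hx]), hx]

lemma IsColoring.empty (G : SimpleGraph V) (ℓ : V → Label) : IsColoring G ℓ ∅ ∅ where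
  subset := subset_rfl
  free := by simp
  indep := by simp
  unique := by simp
  guarded := by simp
  forest T hT hne := by simp at hT; simp [hT] at hne

/-- Every nonempty subset of `A` has positive potential. -/
def IsSparse (G : SimpleGraph V) (ℓ : V → Label) (A : Finset V) : Prop :=
  ∀ S ⊆ A, S.Nonempty → 1 ≤ potential G ℓ S

/-- A counterexample, with the fewest vertices, to the claim that sparse labelled graphs have
colorings. The graph and the labels vary, the ambient vertex type is fixed. -/
structure IsMinimal (G : SimpleGraph V) (ℓ : V → Label) (A : Finset V) : Prop where
  sparse : IsSparse G ℓ A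
  not_coloring : ∀ I, ¬ IsColoring G ℓ A I
  exists_coloring : ∀ (G' : SimpleGraph V) (ℓ' : V → Label) (A' : Finset V), #A' < #A →
    IsSparse G' ℓ' A' → ∃ I, IsColoring G' ℓ' A' I

lemma IsSparse.mono (h : IsSparse G ℓ A) (hB : B ⊆ A) : IsSparse G ℓ B :=
  fun S hS => h S (hS.trans hB)

lemma IsMinimal.elim (h : IsMinimal G ℓ A) (hc : IsColoring G ℓ B I) (hAB : A ⊆ B) : False :=
  h.not_coloring _ (hc.restrict hAB)

lemma IsMinimal.coloring_of_ssubset (h : IsMinimal G ℓ A) (hB : B ⊂ A) :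
    ∃ I, IsColoring G ℓ B I :=
  h.exists_coloring G ℓ B (card_lt_card hB) (h.sparse.mono hB.1)

end

/-! ### The gap lemma -/

section

variable {V : Type*} {G : SimpleGraph V} {ℓ : V → Label} {A W I T : Finset V} {x y z v : V}

/-- The graph obtained by shrinking the forest part `W \ I` of a coloured set `W` to the single
vertex `z ∈ W`; edges to `I` are dropped. -/
def collapseGraph (G : SimpleGraph V) (W I : Finset V) (z : V) : SimpleGraph V where
  Adj x y := (x ∉ W ∧ y ∉ W ∧ G.Adj x y) ∨
    (x = z ∧ y ≠ z ∧ y ∉ W ∧ ∃ f ∈ W \ I, G.Adj y f) ∨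
    (y = z ∧ x ≠ z ∧ x ∉ W ∧ ∃ f ∈ W \ I, G.Adj x f)
  symm := ⟨by
    rintro x y (⟨hx, hy, h⟩ | h | h)
    · exact Or.inl ⟨hy, hx, h.symm⟩
    · exact Or.inr (Or.inr h)
    · exact Or.inr (Or.inl h)⟩
  loopless := ⟨by
    rintro x (⟨-, -, h⟩ | ⟨h, h', -⟩ | ⟨h, h', -⟩)
    · exact G.loopless.irrefl _ h
    · exact h' h
    · exact h' h⟩

/-- The labels that go with `collapseGraph`: the new vertex `z` and the neighbours of `I` are
guarded. -/
noncomputable def collapseLabel (G : SimpleGraph V) (ℓ : V → Label) (I : Finset V) (z : V) :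
    V → Label :=
  fun x => if x = z ∨ ∃ i ∈ I, G.Adj x i then Label.guarded else ℓ x

lemma degSum_collapseGraph (hz : z ∈ W) (hT : Disjoint T W) :
    degSum (collapseGraph G W I z) T = degSum G T := by
  refine degSum_congr fun x hx y hy => ?_
  have hxW := disjoint_left.1 hT hx
  have hyW := disjoint_left.1 hT hy
  have hxz : x ≠ z := by rintro rfl; exact hxW hz
  have hyz : y ≠ z := by rintro rfl; exact hyW hz
  simp [collapseGraph, hxW, hyW, hxz, hyz]

lemma degIn_collapseGraph (hz : z ∈ W) (hT : Disjoint T W)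
    (h1 : ∀ y ∈ T, degIn G y (W \ I) ≤ 1) :
    degIn (collapseGraph G W I z) z T = ∑ y ∈ T, degIn G y (W \ I) := by
  rw [degIn_eq_sum]
  refine sum_congr rfl fun y hy => ?_
  have hyW := disjoint_left.1 hT hy
  have hyz : y ≠ z := by rintro rfl; exact hyW hz
  have key : (collapseGraph G W I z).Adj z y ↔ ∃ f ∈ W \ I, G.Adj y f := by
    simp [collapseGraph, hz, hyz, hyW]
  split_ifs with hadj
  · obtain ⟨f, hf, hyf⟩ := key.1 hadj
    have := degIn_pos hf hyf
    have := h1 y hy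
    omega
  · symm
    rw [degIn_eq_zero]
    intro f hf hyf
    exact hadj (key.2 ⟨f, hf, hyf⟩)

/-- Weights drop by at most 3 for each edge to `I`. -/
lemma sum_weight_collapseLabel (hz : z ∉ T) :
    ∑ y ∈ T, (ℓ y).weight - 3 * ∑ y ∈ T, (degIn G y I : ℤ) ≤
      ∑ y ∈ T, (collapseLabel G ℓ I z y).weight := by
  rw [mul_sum, ← sum_sub_distrib]
  refine sum_le_sum fun y hy => ?_
  have hyz : y ≠ z := by rintro rfl; exact hz hy
  unfold collapseLabel
  split_ifs with h
  · obtain ⟨i, hi, hyi⟩ := h.resolve_left hyz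
    have := degIn_pos hi hyi
    have := (ℓ y).weight_le
    simp only [Label.weight] at *
    omega
  · omega

/-- A set `W` of potential at most 2 sends at most one edge to an outside vertex, and none to a
guarded one. -/
lemma IsSparse.degIn_le (h : IsSparse G ℓ A) (hW : W ⊆ A) (hpot : potential G ℓ W ≤ 2)
    (hy : y ∈ A) (hyW : y ∉ W) :
    degIn G y W ≤ 1 ∧ (ℓ y = Label.guarded → degIn G y W = 0) := by
  have h1 := h (insert y W) (insert_subset hy hW) ⟨y, mem_insert_self _ _⟩
  rw [potential_insert G ℓ hyW] at h1
  have h2 := (ℓ y).weight_le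
  refine ⟨by omega, fun hl => ?_⟩
  rw [hl] at h1
  simp only [Label.weight] at h1
  omega

lemma degIn_sdiff_add (G : SimpleGraph V) (y : V) (hI : I ⊆ W) :
    degIn G y W = degIn G y (W \ I) + degIn G y I := by
  rw [← degIn_union G y sdiff_disjoint, sdiff_union_of_subset hI]

/-- Combining a coloring of `W` with one of the collapsed graph. -/
lemma IsColoring.of_collapse {I' : Finset V} (hW : W ⊆ A) (hz : z ∈ W) (hI : IsColoring G ℓ W I)
    (hI' : IsColoring (collapseGraph G W I z) (collapseLabel G ℓ I z) (insert z (A \ W)) I')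
    (hdeg : ∀ y ∈ A \ W, degIn G y W ≤ 1 ∧ (ℓ y = Label.guarded → degIn G y W = 0)) :
    IsColoring G ℓ A (I' ∪ I) := by
  have hzg : collapseLabel G ℓ I z z = Label.guarded := by simp [collapseLabel]
  have hzI' : z ∉ I' := fun h => by
    have := hI'.free z h
    rw [hzg] at this; cases this
  have hI'A : ∀ o ∈ I', o ∈ A ∧ o ∉ W := fun o ho => by
    have := hI'.subset ho
    simp only [mem_insert, mem_sdiff] at this
    rcases this with rfl | h
    · exact absurd ho hzI'
    · exact h
  have hlab : ∀ o ∈ A \ W, collapseLabel G ℓ I z o ≠ Label.guarded →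
      (∀ i ∈ I, ¬ G.Adj o i) ∧ collapseLabel G ℓ I z o = ℓ o := by
    intro o ho hg
    unfold collapseLabel at hg ⊢
    split_ifs with h
    · simp [h] at hg
    · exact ⟨fun i hi hoi => h (Or.inr ⟨i, hi, hoi⟩), rfl⟩
  have hne : ∀ y, y ∉ W → y ≠ z := by rintro y hy rfl; exact hy hz
  -- Vertices outside `W` with a neighbour in `W` are not in the independent part.
  have hout : ∀ o ∈ I', ∀ w ∈ W, ¬ G.Adj o w := by
    intro o ho w hw how
    obtain ⟨hoA, hoW⟩ := hI'A o ho
    have hfree := hI'.free o ho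
    by_cases hwI : w ∈ I
    · refine (hlab o (by simp [hoA, hoW]) ?_).1 w hwI how
      rw [hfree]; simp
    · exact hI'.guarded z (mem_insert_self _ _) hzg o ho
        (Or.inr (Or.inl ⟨rfl, hne o hoW, hoW, w, by simp [hw, hwI], how⟩))
  have hadj : ∀ x y, x ∉ W → y ∉ W → G.Adj x y → (collapseGraph G W I z).Adj x y :=
    fun x y hx hy h => Or.inl ⟨hx, hy, h⟩
  -- A vertex outside `W` with a neighbour in `I` has no neighbour in `I'`.
  have hout' : ∀ y ∈ A \ W, ∀ i ∈ I, G.Adj y i → ∀ o ∈ I', ¬ G.Adj y o := by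
    intro y hy i hi hyi o ho hyo
    refine hI'.guarded y (mem_insert_of_mem hy) ?_ o ho
      (hadj y o (mem_sdiff.1 hy).2 (hI'A o ho).2 hyo)
    unfold collapseLabel
    rw [if_pos (Or.inr ⟨i, hi, hyi⟩)]
  refine ⟨?_, ?_, ?_, ?_, ?_, ?_⟩
  · exact union_subset (fun o ho => (hI'A o ho).1) (hI.subset.trans hW)
  · intro i hi
    rcases mem_union.1 hi with hi | hi
    · have h1 := hI'.free i hi
      rwa [(hlab i (by simpa using hI'A i hi) (by rw [h1]; simp)).2] at h1
    · exact hI.free i hi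
  · intro i hi j hj hij
    rcases mem_union.1 hi with hi | hi <;> rcases mem_union.1 hj with hj | hj
    · exact hI'.indep i hi j hj (hadj i j (hI'A i hi).2 (hI'A j hj).2 hij)
    · exact hout i hi j (hI.subset hj) hij
    · exact hout j hj i (hI.subset hi) hij.symm
    · exact hI.indep i hi j hj hij
  · intro v hv i hi j hj hvi hvj
    by_cases hvW : v ∈ W
    · rcases mem_union.1 hi with hi | hi
      · exact absurd hvi.symm (hout i hi v hvW)
      rcases mem_union.1 hj with hj | hj
      · exact absurd hvj.symm (hout j hj v hvW)
      exact hI.unique v hvW i hi j hj hvi hvj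
    · have hvA : v ∈ A \ W := by simp [hv, hvW]
      rcases mem_union.1 hi with hi | hi <;> rcases mem_union.1 hj with hj | hj
      · exact hI'.unique v (mem_insert_of_mem hvA) i hi j hj
          (hadj v i hvW (hI'A i hi).2 hvi) (hadj v j hvW (hI'A j hj).2 hvj)
      · exact absurd hvi (hout' v hvA j hj hvj i hi)
      · exact absurd hvj (hout' v hvA i hi hvi j hj)
      · by_contra hij
        have := two_le_degIn (hI.subset hi) (hI.subset hj) hij hvi hvj
        have := (hdeg v hvA).1
        omega
  · intro v hv hlv i hi hvi
    by_cases hvW : v ∈ W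
    · rcases mem_union.1 hi with hi | hi
      · exact hout i hi v hvW hvi.symm
      · exact hI.guarded v hvW hlv i hi hvi
    · have hvA : v ∈ A \ W := by simp [hv, hvW]
      rcases mem_union.1 hi with hi | hi
      · refine hI'.guarded v (mem_insert_of_mem hvA) ?_ i hi (hadj v i hvW (hI'A i hi).2 hvi)
        unfold collapseLabel
        split_ifs
        · rfl
        · exact hlv
      · have := degIn_pos (hI.subset hi) hvi
        have := (hdeg v hvA).2 hlv
        omega
  · intro T hT hne'
    -- Replace the part of `T` in `W` by the vertex `z`.
    have hTW : Disjoint (T \ W) (T ∩ W) := disjoint_sdiff_inter _ _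
    have hTW' : Disjoint (T \ W) W := sdiff_disjoint
    have hz1 : z ∉ T \ W := by simp [hz]
    have hsub : insert z (T \ W) ⊆ insert z (A \ W) \ I' := by
      intro x hx
      rcases mem_insert.1 hx with rfl | hx
      · simp [hzI']
      · have hxT := (mem_sdiff.1 hx).1
        have hxW := (mem_sdiff.1 hx).2
        have := hT hxT
        simp only [mem_sdiff, mem_union, not_or, mem_insert] at this ⊢
        exact ⟨Or.inr ⟨this.1, hxW⟩, this.2.1⟩
    have hdec : degSum G T = degSum G (T \ W) + degSum G (T ∩ W) +
        2 * ∑ x ∈ T \ W, degIn G x (T ∩ W) := by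
      rw [← degSum_union G hTW, sdiff_union_inter]
    have hcard : #T = #(T \ W) + #(T ∩ W) := by
      rw [← card_union_of_disjoint hTW, sdiff_union_inter]
    rcases (T ∩ W).eq_empty_or_nonempty with he | hne2
    · have hTe : T \ W = T := by
        rw [he, card_empty, add_zero] at hcard
        exact (eq_of_subset_of_card_le sdiff_subset hcard.le)
      have := hI'.forest (T \ W) ((subset_insert _ _).trans hsub) (by rwa [hTe])
      rwa [degSum_collapseGraph hz hTW', hTe] at this
    · have h1 := hI.forest (T ∩ W) (fun x hx => by
        have h1 := hT (mem_inter.1 hx).1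
        have h2 := (mem_inter.1 hx).2
        simp only [mem_sdiff, mem_union, not_or] at h1 ⊢
        exact ⟨h2, h1.2.2⟩) hne2
      have h2 := hI'.forest _ hsub ⟨z, mem_insert_self _ _⟩
      rw [degSum_insert _ hz1, card_insert_of_notMem hz1, degSum_collapseGraph hz hTW',
        degIn_collapseGraph hz hTW'] at h2
      · have h3 : ∑ x ∈ T \ W, degIn G x (T ∩ W) ≤ ∑ x ∈ T \ W, degIn G x (W \ I) := by
          refine sum_le_sum fun x _ => degIn_mono G x fun y hy => ?_
          have h1 := hT (mem_inter.1 hy).1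
          have h2 := (mem_inter.1 hy).2
          simp only [mem_sdiff, mem_union, not_or] at h1 ⊢
          exact ⟨h2, h1.2.2⟩
        omega
      · intro y hy
        have hyA : y ∈ A \ W := by
          have h1 := hT (mem_sdiff.1 hy).1
          have h2 := (mem_sdiff.1 hy).2
          simp only [mem_sdiff] at h1 ⊢
          exact ⟨h1.1, h2⟩
        have := degIn_sdiff_add G y hI.subset
        have := (hdeg y hyA).1
        omega

/-- Shrinking a coloured set `W` of potential at most 2 to one guarded vertex (of weight 2) gives a
sparse graph, except when `W` has potential exactly 2 and is attached to a set `T` by a single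
edge, which ends in the independent part of `W`, such that `T ∪ W` has the least potential 1. -/
lemma IsMinimal.exists_bridge (h : IsMinimal G ℓ A) (hW : W ⊂ A) (hcard : 2 ≤ #W)
    (hpot : potential G ℓ W ≤ 2) (hI : IsColoring G ℓ W I) :
    ∃ T ⊆ A \ W, potential G ℓ (T ∪ W) = 1 ∧ potential G ℓ W = 2 ∧
      ∑ y ∈ T, degIn G y (W \ I) = 0 ∧ ∑ y ∈ T, degIn G y I = 1 := by
  by_contra hcon
  obtain ⟨z, hz⟩ : W.Nonempty := card_pos.1 (by omega)
  have hdeg : ∀ y ∈ A \ W, degIn G y W ≤ 1 ∧ (ℓ y = Label.guarded → degIn G y W = 0) :=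
    fun y hy => h.sparse.degIn_le hW.1 hpot (mem_sdiff.1 hy).1 (mem_sdiff.1 hy).2
  have hlt : #(insert z (A \ W)) < #A := by
    rw [card_insert_of_notMem (by simp [hz]), card_sdiff_of_subset hW.1]
    have := card_le_card hW.1
    omega
  have hsp : IsSparse (collapseGraph G W I z) (collapseLabel G ℓ I z) (insert z (A \ W)) := by
    have key : ∀ T ⊆ A \ W, potential G ℓ T - 3 * ∑ y ∈ T, (degIn G y I : ℤ) ≤
        potential (collapseGraph G W I z) (collapseLabel G ℓ I z) T ∧
        potential G ℓ (T ∪ W) = potential G ℓ T + potential G ℓ W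
          - 4 * ∑ y ∈ T, (degIn G y (W \ I) : ℤ) - 4 * ∑ y ∈ T, (degIn G y I : ℤ) ∧
        degIn (collapseGraph G W I z) z T = ∑ y ∈ T, degIn G y (W \ I) := by
      intro T hT
      have hTW : Disjoint T W := disjoint_of_subset_left hT sdiff_disjoint
      refine ⟨?_, ?_, ?_⟩
      · unfold potential
        rw [degSum_collapseGraph hz hTW]
        have := sum_weight_collapseLabel (G := G) (ℓ := ℓ) (I := I) (z := z) (T := T)
          (fun hzT => disjoint_left.1 hTW hzT hz)
        omega
      · rw [potential_union G ℓ hTW]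
        have : ∑ y ∈ T, (degIn G y W : ℤ) =
            ∑ y ∈ T, (degIn G y (W \ I) : ℤ) + ∑ y ∈ T, (degIn G y I : ℤ) := by
          rw [← sum_add_distrib]
          refine sum_congr rfl fun y _ => ?_
          rw [degIn_sdiff_add G y hI.subset]
          push_cast; rfl
        rw [this]
        ring
      · refine degIn_collapseGraph hz hTW fun y hy => ?_
        have h1 := (hdeg y (hT hy)).1
        have h2 := degIn_sdiff_add G y hI.subset
        omega
    have hpos : ∀ T ⊆ A \ W, 1 ≤ potential G ℓ (T ∪ W) := fun T hT =>
      h.sparse _ (union_subset (hT.trans sdiff_subset) hW.1) ⟨z, mem_union_right _ hz⟩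
    intro S hS hne
    by_cases hzS : z ∈ S
    · obtain ⟨T, hzT, rfl⟩ : ∃ T, z ∉ T ∧ S = insert z T := ⟨S.erase z, by simp, by simp [hzS]⟩
      have hT : T ⊆ A \ W := fun x hx => by
        rcases mem_insert.1 (hS (mem_insert_of_mem hx)) with rfl | h'
        · exact absurd hx hzT
        · exact h'
      obtain ⟨k1, k2, k3⟩ := key T hT
      have k4 := hpos T hT
      rw [potential_insert _ _ hzT, k3]
      have : (collapseLabel G ℓ I z z).weight = 2 := by simp [collapseLabel, Label.weight]
      have : 0 ≤ ∑ y ∈ T, (degIn G y I : ℤ) := by positivity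
      push_cast
      linarith
    · have hT : S ⊆ A \ W := fun x hx => by
        rcases mem_insert.1 (hS hx) with rfl | h'
        · exact absurd hx hzS
        · exact h'
      obtain ⟨k1, k2, k3⟩ := key S hT
      have k4 := hpos S hT
      have k5 := h.sparse S (hT.trans sdiff_subset) hne
      have k6 : ¬ (potential G ℓ (S ∪ W) = 1 ∧ potential G ℓ W = 2 ∧
        ∑ y ∈ S, degIn G y (W \ I) = 0 ∧ ∑ y ∈ S, degIn G y I = 1) := fun h' =>
        hcon ⟨S, hT, h'⟩
      zify at k6
      have h1 : 0 ≤ ∑ y ∈ S, (degIn G y I : ℤ) := by positivity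
      have h2 : 0 ≤ ∑ y ∈ S, (degIn G y (W \ I) : ℤ) := by positivity
      omega
  obtain ⟨I', hI'⟩ := h.exists_coloring _ _ _ hlt hsp
  exact h.not_coloring _ (hI.of_collapse hW.1 hz hI' hdeg)

lemma IsMinimal.two_le_potential (h : IsMinimal G ℓ A) (hW : W ⊂ A) (hcard : 2 ≤ #W) :
    2 ≤ potential G ℓ W := by
  by_contra hlt
  obtain ⟨I, hI⟩ := h.coloring_of_ssubset hW
  obtain ⟨T, -, -, h2, -⟩ := h.exists_bridge hW hcard (by omega) hI
  omega

lemma IsSparse.forced_singleton (h : IsSparse G ℓ A)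
    (h2 : ℓ x = Label.free → ∀ S ⊆ A, x ∈ S → 2 ≤ potential G ℓ S) :
    IsSparse G (forced ℓ {x}) A := by
  intro S hS hne
  have h1 := h S hS hne
  rw [potential_forced]
  by_cases hx : x ∈ S ∧ ℓ x = Label.free
  · have := h2 hx.2 S hS hx.1
    have : #{u ∈ S | u ∈ ({x} : Finset V) ∧ ℓ u = Label.free} ≤ 1 := by
      rw [← card_singleton x]
      exact card_le_card fun u hu => by simp only [mem_filter] at hu; exact hu.2.1
    omega
  · rw [filter_false_of_mem]
    · simpa using h1
    · rintro u hu ⟨hux, hl⟩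
      rw [mem_singleton] at hux
      subst hux
      exact hx ⟨hu, hl⟩

/-- Two colorings can be put together along a single edge `xy` both of whose ends are in the forest
part. -/
lemma IsColoring.union {I₁ I₂ : Finset V} (h₁ : IsColoring G ℓ W I₁) (h₂ : IsColoring G ℓ T I₂)
    (hd : Disjoint T W) (hx : x ∉ I₁) (hy : y ∉ I₂)
    (hxy : ∀ t ∈ T, ∀ w ∈ W, G.Adj t w → t = y ∧ w = x) : IsColoring G ℓ (T ∪ W) (I₂ ∪ I₁) := by
  have hTW : ∀ t ∈ T, t ∉ W := fun t ht => disjoint_left.1 hd ht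
  have c1 : ∀ t ∈ T, ∀ i ∈ I₁, ¬ G.Adj t i := fun t ht i hi hti => by
    have := (hxy t ht i (h₁.subset hi) hti).2
    exact hx (this ▸ hi)
  have c2 : ∀ w ∈ W, ∀ i ∈ I₂, ¬ G.Adj w i := fun w hw i hi hwi => by
    have := (hxy i (h₂.subset hi) w hw hwi.symm).1
    exact hy (this ▸ hi)
  refine ⟨union_subset_union h₂.subset h₁.subset, ?_, ?_, ?_, ?_, ?_⟩
  · intro i hi
    rcases mem_union.1 hi with hi | hi
    · exact h₂.free i hi
    · exact h₁.free i hi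
  · intro i hi j hj
    rcases mem_union.1 hi with hi | hi <;> rcases mem_union.1 hj with hj | hj
    · exact h₂.indep i hi j hj
    · exact c1 i (h₂.subset hi) j hj
    · exact c2 i (h₁.subset hi) j hj
    · exact h₁.indep i hi j hj
  · intro v hv i hi j hj hvi hvj
    rcases mem_union.1 hv with hv | hv
    · rcases mem_union.1 hi with hi | hi
      · rcases mem_union.1 hj with hj | hj
        · exact h₂.unique v hv i hi j hj hvi hvj
        · exact absurd hvj (c1 v hv j hj)
      · exact absurd hvi (c1 v hv i hi)
    · rcases mem_union.1 hi with hi | hi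
      · exact absurd hvi (c2 v hv i hi)
      · rcases mem_union.1 hj with hj | hj
        · exact absurd hvj (c2 v hv j hj)
        · exact h₁.unique v hv i hi j hj hvi hvj
  · intro v hv hlv i hi
    rcases mem_union.1 hv with hv | hv <;> rcases mem_union.1 hi with hi | hi
    · exact h₂.guarded v hv hlv i hi
    · exact c1 v hv i hi
    · exact c2 v hv i hi
    · exact h₁.guarded v hv hlv i hi
  · intro S hS hne
    have hd' : Disjoint (S ∩ T) (S ∩ W) :=
      disjoint_of_subset_left inter_subset_right (disjoint_of_subset_right inter_subset_right hd)
    have hSe : S ∩ T ∪ S ∩ W = S := by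
      rw [← inter_union_distrib_left, inter_eq_left]
      exact hS.trans sdiff_subset
    have hS1 : S ∩ T ⊆ T \ I₂ := fun u hu => by
      have h1 := hS (mem_inter.1 hu).1
      have h2 := (mem_inter.1 hu).2
      simp only [mem_sdiff, mem_union, not_or] at h1 ⊢
      exact ⟨h2, h1.2.1⟩
    have hS2 : S ∩ W ⊆ W \ I₁ := fun u hu => by
      have h1 := hS (mem_inter.1 hu).1
      have h2 := (mem_inter.1 hu).2
      simp only [mem_sdiff, mem_union, not_or] at h1 ⊢
      exact ⟨h2, h1.2.2⟩
    have hdec := degSum_union G hd'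
    have hcard := card_union_of_disjoint hd'
    rw [hSe] at hdec hcard
    have hcross : ∑ u ∈ S ∩ T, degIn G u (S ∩ W) ≤ 1 := by
      refine (sum_le_sum (g := fun u => if u = y then 1 else 0) fun u hu => ?_).trans
        (by rw [sum_ite_eq']; split_ifs <;> simp)
      have huT := (mem_inter.1 hu).2
      split_ifs with huy
      · exact degIn_le_one (p := x) fun w hw huw => (hxy u huT w (mem_inter.1 hw).2 huw).2
      · rw [Nat.le_zero, degIn_eq_zero]
        exact fun w hw huw => huy (hxy u huT w (mem_inter.1 hw).2 huw).1
    rcases (S ∩ T).eq_empty_or_nonempty with he | hne1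
    · have hne2 : (S ∩ W).Nonempty := by
        rw [nonempty_iff_ne_empty]; intro he'
        rw [he, he'] at hSe
        rw [← hSe] at hne
        simp at hne
      have h3 := h₁.forest _ hS2 hne2
      rw [he] at hSe
      simp only [empty_union] at hSe
      rwa [hSe] at h3
    · have h4 := h₂.forest _ hS1 hne1
      rcases (S ∩ W).eq_empty_or_nonempty with he | hne2
      · rw [he] at hSe
        simp only [union_empty] at hSe
        rwa [hSe] at h4
      · have h3 := h₁.forest _ hS2 hne2
        omega

/-- In a minimal counterexample, proper subsets with at least two vertices have potential at least
3. -/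
lemma IsMinimal.three_le_potential (h : IsMinimal G ℓ A) (hW : W ⊂ A) (hcard : 2 ≤ #W) :
    3 ≤ potential G ℓ W := by
  by_contra hlt
  have hW2 := h.two_le_potential hW hcard
  obtain ⟨I, hI⟩ := h.coloring_of_ssubset hW
  obtain ⟨T, hT, h1, h2, hF, hIT⟩ := h.exists_bridge hW hcard (by omega) hI
  have hd : Disjoint T W := disjoint_of_subset_left hT sdiff_disjoint
  have hTA : T ⊆ A := hT.trans sdiff_subset
  have hTWA : T ∪ W = A := by
    by_contra hne
    have hss : T ∪ W ⊂ A := lt_of_le_of_ne (union_subset hTA hW.1) hne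
    have := h.two_le_potential hss (hcard.trans (card_le_card subset_union_right))
    omega
  -- The single edge `yx` between `T` and `W`.
  obtain ⟨y, hyT, hy0⟩ : ∃ y ∈ T, degIn G y I ≠ 0 := by
    by_contra! hc
    rw [sum_eq_zero hc] at hIT
    omega
  obtain ⟨x, hxI, hyx⟩ : ∃ x ∈ I, G.Adj y x := by
    by_contra! hc
    exact hy0 (degIn_eq_zero.2 hc)
  have hdegT : ∀ t ∈ T, degIn G t W = degIn G t I := fun t ht => by
    have h3 := degIn_sdiff_add G t hI.subset
    have h4 := (sum_eq_zero_iff.1 hF) t ht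
    omega
  have hxy : ∀ t ∈ T, ∀ w ∈ W, G.Adj t w → t = y ∧ w = x := by
    intro t ht w hw htw
    have hpos : 1 ≤ degIn G t I := hdegT t ht ▸ degIn_pos hw htw
    have hyp : 1 ≤ degIn G y I := degIn_pos hxI hyx
    have hty : t = y := by
      by_contra hne
      have h5 : ∑ u ∈ {t, y}, degIn G u I ≤ ∑ u ∈ T, degIn G u I :=
        sum_le_sum_of_subset (by
          intro u hu
          simp only [mem_insert, mem_singleton] at hu
          rcases hu with rfl | rfl <;> assumption)
      rw [sum_pair hne] at h5
      omega
    subst hty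
    refine ⟨rfl, ?_⟩
    by_contra hne
    have h6 := two_le_degIn hw (hI.subset hxI) hne htw hyx
    have h7 : degIn G t I ≤ ∑ u ∈ T, degIn G u I :=
      single_le_sum (f := fun u => degIn G u I) (fun _ _ => Nat.zero_le _) ht
    rw [hdegT t ht] at h6
    omega
  have hxW := hI.subset hxI
  have hTss : T ⊂ A := by
    refine lt_of_le_of_ne hTA ?_
    rintro rfl
    exact disjoint_left.1 hd (hW.1 hxW) hxW
  -- Color `W` with `x` in the forest part.
  obtain ⟨I₁, hI₁⟩ := h.exists_coloring G (forced ℓ {x}) W (card_lt_card hW)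
    ((h.sparse.mono hW.1).forced_singleton fun _ S hS hxS => by
      rcases Nat.lt_or_ge #S 2 with hc | hc
      · have : S = {x} := by
          have h1 : #S = 1 := by
            have := card_pos.2 ⟨x, hxS⟩
            omega
          obtain ⟨u, rfl⟩ := card_eq_one.1 h1
          rw [mem_singleton.1 hxS]
        rw [this, potential_singleton]
        exact Label.two_le_weight _
      · exact h.two_le_potential (lt_of_le_of_lt hS hW) hc)
  -- Color `T` with `y` in the forest part.
  obtain ⟨I₂, hI₂⟩ := h.exists_coloring G (forced ℓ {y}) T (card_lt_card hTss)
    ((h.sparse.mono hTA).forced_singleton fun _ S hS hyS => by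
      have h8 := h.sparse (S ∪ W) (union_subset (hS.trans hTA) hW.1) ⟨x, by simp [hxW]⟩
      rw [potential_union G ℓ (disjoint_of_subset_left hS hd)] at h8
      have h9 : (degIn G y W : ℤ) ≤ ∑ u ∈ S, (degIn G u W : ℤ) :=
        single_le_sum (f := fun u => (degIn G u W : ℤ)) (fun _ _ => by positivity) hyS
      have h10 := degIn_pos hxW hyx
      omega)
  have hI₁' := hI₁.of_forced
  have hI₂' := hI₂.of_forced
  exact h.not_coloring _ (hTWA ▸ hI₁'.1.union hI₂'.1 hd (hI₁'.2 x (by simp))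
    (hI₂'.2 y (by simp)) hxy)

end

/-! ### Small degrees and paths of vertices of degree two -/

section

variable {V : Type*} {G : SimpleGraph V} {ℓ : V → Label} {A B I Y : Finset V}
  {f p q v x y z : V}

/-- The exceptions in `three_le_potential` are the sets of a single guarded vertex. -/
lemma IsMinimal.three_le_potential_of_mem (h : IsMinimal G ℓ A) {S : Finset V} (hS : S ⊂ A)
    (hx : x ∈ S) (hl : ℓ x ≠ Label.guarded) : 3 ≤ potential G ℓ S := by
  rcases Nat.lt_or_ge #S 2 with hc | hc
  · have h1 : #S = 1 := by
      have := card_pos.2 ⟨x, hx⟩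
      omega
    obtain ⟨u, rfl⟩ := card_eq_one.1 h1
    obtain rfl := mem_singleton.1 hx
    rw [potential_singleton]
    cases hu : ℓ x <;> simp_all [Label.weight]
  · exact h.three_le_potential hS hc

lemma IsMinimal.one_le_potential_forced (h : IsMinimal G ℓ A) {S : Finset V} (hS : S ⊂ A)
    (hne : S.Nonempty) (hY : #(S ∩ Y) ≤ 2) : 1 ≤ potential G (forced ℓ Y) S := by
  have h1 := potential_sub_le_forced G ℓ Y S
  by_cases hx : ∃ x ∈ S, ℓ x = Label.free
  · obtain ⟨x, hxS, hx⟩ := hx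
    have := h.three_le_potential_of_mem hS hxS (by rw [hx]; simp)
    omega
  · rw [potential_forced, filter_false_of_mem fun x hxS hx' => hx ⟨x, hxS, hx'.2⟩]
    simpa using h.sparse S hS.1 hne

/-- Up to two vertices of a proper subset can be forced into the forest part. -/
lemma IsMinimal.exists_coloring_forced (h : IsMinimal G ℓ A) (hB : B ⊂ A) (hY : #Y ≤ 2) :
    ∃ I, IsColoring G ℓ B I ∧ ∀ y ∈ Y, y ∉ I := by
  obtain ⟨I, hI⟩ := h.exists_coloring G (forced ℓ Y) B (card_lt_card hB) fun S hS hne =>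
    h.one_le_potential_forced (lt_of_le_of_lt hS hB) hne
      ((card_le_card inter_subset_right).trans hY)
  exact ⟨I, hI.of_forced⟩

/-- A vertex of degree at most 1 is reducible: force its neighbour, if there is one, into the forest
part, so that even a guarded vertex can be added to that part. -/
lemma IsMinimal.two_le_degIn (h : IsMinimal G ℓ A) (hv : v ∈ A) : 2 ≤ degIn G v A := by
  by_contra hlt
  have hY : #{u ∈ A | G.Adj v u} ≤ 1 := by
    unfold degIn at hlt
    omega
  obtain ⟨I, hI, hIY⟩ := h.exists_coloring_forced (erase_ssubset hv)
    (Y := {u ∈ A | G.Adj v u}) (by omega)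
  have hnb : ∀ i ∈ I, ¬ G.Adj v i := fun i hi hvi =>
    hIY i (by simp [mem_of_mem_erase (hI.subset hi), hvi]) hi
  obtain ⟨p, hp⟩ : ∃ p, ∀ u ∈ A, G.Adj v u → u = p := by
    have : Nonempty V := ⟨v⟩
    obtain ⟨p, hp⟩ := card_le_one_iff_subset_singleton.1 hY
    exact ⟨p, fun u hu hvu => by simpa using hp (show u ∈ _ by simp [hu, hvu])⟩
  have hvI : v ∉ I := fun hvI => by simpa using hI.subset hvI
  refine h.elim (hI.insert_forest (p := p) (q := v) (by simp) (fun _ => hnb)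
    (fun u hu hvu => Or.inl (hp u (mem_of_mem_erase hu) hvu)) (by simp [hvI])
    (.of_notMem_right (by simp))) (by rw [insert_erase hv])

/-- The neighbours of `v` in `A` are exactly the two vertices `p` and `q`. -/
structure HasTwoNeighbors (G : SimpleGraph V) (A : Finset V) (v p q : V) : Prop where
  mem : v ∈ A
  left_mem : p ∈ A
  right_mem : q ∈ A
  ne : p ≠ q
  left : G.Adj v p
  right : G.Adj v q
  eq_or_eq : ∀ u ∈ A, G.Adj v u → u = p ∨ u = q

lemma HasTwoNeighbors.symm (h : HasTwoNeighbors G A v p q) : HasTwoNeighbors G A v q p :=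
  ⟨h.mem, h.right_mem, h.left_mem, h.ne.symm, h.right, h.left, fun u hu hvu =>
    (h.eq_or_eq u hu hvu).symm⟩

lemma exists_hasTwoNeighbors (hv : v ∈ A) (h : degIn G v A = 2) :
    ∃ p q, HasTwoNeighbors G A v p q := by
  obtain ⟨p, q, hne, hpq⟩ := card_eq_two.1 h
  have key : ∀ u, u ∈ A ∧ G.Adj v u ↔ u = p ∨ u = q := fun u => by
    have : u ∈ ({y ∈ A | G.Adj v y} : Finset V) ↔ u ∈ ({p, q} : Finset V) := by rw [hpq]
    simpa using this
  have hp := (key p).2 (Or.inl rfl)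
  have hq := (key q).2 (Or.inr rfl)
  exact ⟨p, q, hv, hp.1, hq.1, hne, hp.2, hq.2, fun u hu hvu => (key u).1 ⟨hu, hvu⟩⟩

lemma HasTwoNeighbors.degIn_eq (h : HasTwoNeighbors G A v p q) : degIn G v A = 2 := by
  rw [← card_pair h.ne, degIn]
  congr 1
  ext u
  simp only [mem_filter, mem_insert, mem_singleton]
  constructor
  · exact fun hu => h.eq_or_eq u hu.1 hu.2
  · rintro (rfl | rfl)
    · exact ⟨h.left_mem, h.left⟩
    · exact ⟨h.right_mem, h.right⟩

/-- A free vertex of degree two. -/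
def IsTwo (G : SimpleGraph V) (ℓ : V → Label) (A : Finset V) (x : V) : Prop :=
  x ∈ A ∧ ℓ x = Label.free ∧ degIn G x A = 2

lemma IsTwo.exists_neighbors (h : IsTwo G ℓ A x) (hp : p ∈ A) (hxp : G.Adj x p) :
    ∃ q, HasTwoNeighbors G A x p q := by
  obtain ⟨a, b, hab⟩ := exists_hasTwoNeighbors h.1 h.2.2
  rcases hab.eq_or_eq p hp hxp with rfl | rfl
  · exact ⟨b, hab⟩
  · exact ⟨a, hab.symm⟩

/-- Extend a coloring by a vertex of degree two in the forest part. -/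
lemma IsColoring.insert_two (h : IsColoring G ℓ B I) (hx : HasTwoNeighbors G A x p q)
    (hl : ℓ x ≠ Label.guarded) (hB : B ⊆ A) (hxB : x ∉ B)
    (hI : ¬ (p ∈ I ∧ q ∈ I)) (hs : (p ∉ B ∨ p ∈ I) ∨ (q ∉ B ∨ q ∈ I)) :
    IsColoring G ℓ (insert x B) I := by
  refine h.insert_forest hxB (fun h => absurd h hl) (fun u hu => hx.eq_or_eq u (hB hu)) hI ?_
  rcases hs with hs | hs
  · exact .of_notMem_left (by simp only [mem_sdiff]; tauto)
  · exact .of_notMem_right (by simp only [mem_sdiff]; tauto)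

/-- Forest vertices of degree two are reducible: replace the vertex by an edge that joins its
neighbours. -/
lemma IsMinimal.three_le_degIn (h : IsMinimal G ℓ A) (hf : f ∈ A) (hl : ℓ f = Label.forest) :
    3 ≤ degIn G f A := by
  by_contra hlt
  obtain ⟨a, b, hab⟩ := exists_hasTwoNeighbors hf
    (le_antisymm (by omega) (h.two_le_degIn hf))
  have hlg : ℓ f ≠ Label.guarded := by rw [hl]; simp
  have hfa := hab.left.ne
  have hfb := hab.right.ne
  have hane := hab.ne
  by_cases hadj : G.Adj a b
  · -- The triangle has potential at most 2, so it is the whole graph.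
    have hbs : potential G ℓ {b} = (ℓ b).weight := potential_singleton G ℓ b
    have h1 := potential_insert_le_one (ℓ := ℓ) (S := {b}) (by simpa using hane)
      (mem_singleton_self b) hadj
    have h2 := potential_insert_le_two (ℓ := ℓ) (v := f) (S := {a, b}) (by simp [hfa, hfb])
      (mem_insert_self a {b}) (by simp) hane hab.left hab.right
    have hsub : ({f, a, b} : Finset V) ⊆ A := by
      intro u hu
      simp only [mem_insert, mem_singleton] at hu
      rcases hu with rfl | rfl | rfl
      · exact hf
      · exact hab.left_mem
      · exact hab.right_mem
    have hwa := (ℓ a).weight_le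
    have hwb := (ℓ b).weight_le
    rw [hl] at h2
    simp only [Label.weight] at h2
    have hA : ({f, a, b} : Finset V) = A := by
      by_contra hne
      have := h.three_le_potential_of_mem (lt_of_le_of_ne hsub hne) (mem_insert_self f _) hlg
      omega
    have h3 := h.sparse _ hsub ⟨f, mem_insert_self _ _⟩
    have hab2 : 9 ≤ (ℓ a).weight + (ℓ b).weight := by omega
    -- One of `a`, `b` is free and the other is not guarded.
    have hcol : ∀ s t, s ≠ t → f ≠ s → f ≠ t → HasTwoNeighbors G A f s t → ℓ s = Label.free →
        ℓ t ≠ Label.guarded → A ⊆ {f, t, s} → False := by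
      intro s t hst hfs hft hN hs ht hsubst
      have c1 := (IsColoring.empty G ℓ).insert_indep (v := s) (by simp) hs (by simp)
      have c2 := c1.insert_forest (v := t) (p := s) (q := t) (by simp [hst.symm])
        (fun h' => absurd h' ht) (by simp) (by simp [hst.symm])
        (.of_notMem_left (by simp))
      have c3 := c2.insert_two hN hlg
        (by
          intro u hu
          simp only [insert_empty_eq, mem_insert, mem_singleton] at hu
          rcases hu with rfl | rfl
          · exact hN.right_mem
          · exact hN.left_mem) (by simp [hfs, hft]) (by simp [hst.symm]) (by simp)
      exact h.elim c3 (by simpa using hsubst)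
    cases ha : ℓ a
    · refine hcol a b hane hfa hfb hab ha (fun hb => ?_) ?_
      · rw [ha, hb] at hab2; simp [Label.weight] at hab2
      · rw [← hA]; intro u; simp; tauto
    · refine hcol b a hane.symm hfb hfa hab.symm ?_ (by rw [ha]; simp) hA.symm.subset
      cases hb : ℓ b
      · rfl
      · rw [ha, hb] at hab2; simp [Label.weight] at hab2
      · rw [ha, hb] at hab2; simp [Label.weight] at hab2
    · rw [ha, show Label.guarded.weight = 2 from rfl] at hab2
      omega
  · have hsp : IsSparse (G ⊔ SimpleGraph.edge a b) ℓ (A.erase f) := by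
      intro S hS hne
      by_cases hmem : a ∈ S ∧ b ∈ S
      · rw [potential_sup_edge G ℓ hmem.1 hmem.2 hane hadj]
        have hfS : f ∉ S := fun hfS => by simpa using hS hfS
        have h1 := potential_insert_le_two (ℓ := ℓ) hfS hmem.1 hmem.2 hane hab.left hab.right
        have h2 := h.sparse (insert f S) (insert_subset hf (hS.trans (erase_subset _ _)))
          ⟨f, mem_insert_self _ _⟩
        rw [hl] at h1
        simp only [Label.weight] at h1
        omega
      · rw [potential_sup_edge_of_notMem G ℓ (by tauto)]
        exact h.sparse S (hS.trans (erase_subset _ _)) hne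
    obtain ⟨I, hI⟩ := h.exists_coloring _ ℓ _ (card_erase_lt_of_mem hf) hsp
    have hI' : IsColoring G ℓ (A.erase f) I :=
      hI.weaken (fun x _ y _ h => Or.inl h) (fun _ _ h => h) fun _ _ h => h
    have hIab : ¬ (a ∈ I ∧ b ∈ I) := fun hI2 => hI.indep a hI2.1 b hI2.2
      (Or.inr (by simp [SimpleGraph.edge_adj, hane]))
    exact h.elim (hI'.insert_forest (v := f) (p := a) (q := b) (by simp)
      (fun h' => absurd h' hlg) (fun u hu => hab.eq_or_eq u (mem_of_mem_erase hu)) hIab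
      (hI.forest.isSeparated hane hadj)) (by rw [insert_erase hf])

/-- Three consecutive free vertices of degree two are reducible: put the middle one into the
independent part, unless the path already has an end in that part. -/
lemma IsMinimal.not_isTwo_path (h : IsMinimal G ℓ A) (hy : HasTwoNeighbors G A y x z)
    (hyl : ℓ y = Label.free) (hx : IsTwo G ℓ A x) (hz : IsTwo G ℓ A z) : False := by
  obtain ⟨a, hxa⟩ := hx.exists_neighbors hy.mem hy.left.symm
  obtain ⟨b, hzb⟩ := hz.exists_neighbors hy.mem hy.right.symm
  have hxl : ℓ x ≠ Label.guarded := by rw [hx.2.1]; simp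
  have hzl : ℓ z ≠ Label.guarded := by rw [hz.2.1]; simp
  have hyl' : ℓ y ≠ Label.guarded := by rw [hyl]; simp
  have hxy := hxa.left.ne
  have hzy := hzb.left.ne
  have hxz := hy.ne
  have hya := hxa.ne
  have hyb := hzb.ne
  have hB : A \ {x, y, z} ⊂ A := sdiff_ssubset (by
    intro u hu
    simp only [mem_insert, mem_singleton] at hu
    rcases hu with rfl | rfl | rfl
    · exact hx.1
    · exact hy.mem
    · exact hz.1) ⟨x, by simp⟩
  obtain ⟨I, hI⟩ := h.coloring_of_ssubset hB
  have hxI : x ∉ I := fun h' => by simpa using hI.subset h'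
  have hyI : y ∉ I := fun h' => by simpa using hI.subset h'
  have hzI : z ∉ I := fun h' => by simpa using hI.subset h'
  by_cases haI : a ∈ I
  · have c1 := hI.insert_two hzb hzl hB.1 (by simp) (by simp [hyI]) (by simp)
    have c2 := c1.insert_two hy hyl' (insert_subset hz.1 hB.1) (by simp [hzy.symm])
      (by simp [hxI]) (by simp [hxz])
    have c3 := c2.insert_two hxa hxl (insert_subset hy.mem (insert_subset hz.1 hB.1))
      (by simp [hxy, hxz]) (by simp [hyI]) (by simp [haI])
    exact h.elim c3 (by intro u hu; simp only [mem_insert, mem_sdiff, mem_singleton]; tauto)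
  by_cases hbI : b ∈ I
  · have c1 := hI.insert_two hxa hxl hB.1 (by simp) (by simp [hyI]) (by simp)
    have c2 := c1.insert_two hy hyl' (insert_subset hx.1 hB.1) (by simp [hxy.symm])
      (by simp [hxI]) (by simp [hxz.symm])
    have c3 := c2.insert_two hzb hzl (insert_subset hy.mem (insert_subset hx.1 hB.1))
      (by simp [hzy, hxz.symm]) (by simp [hyI]) (by simp [hbI])
    exact h.elim c3 (by intro u hu; simp only [mem_insert, mem_sdiff, mem_singleton]; tauto)
  · have c1 := hI.insert_indep (v := y) (by simp) hyl (fun u hu hyu => by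
      simp only [mem_sdiff, mem_insert, mem_singleton, not_or] at hu
      rcases hy.eq_or_eq u hu.1 hyu with rfl | rfl <;> tauto)
    have c2 := c1.insert_two hxa hxl (insert_subset hy.mem hB.1) (by simp [hxy])
      (by simp [haI, hya.symm]) (by simp)
    have c3 := c2.insert_two hzb hzl (insert_subset hx.1 (insert_subset hy.mem hB.1))
      (by simp [hzy, hxz.symm]) (by simp [hbI, hyb.symm]) (by simp)
    exact h.elim c3 (by intro u hu; simp only [mem_insert, mem_sdiff, mem_singleton]; tauto)

end

/-! ### Free vertices with neighbours of degree two -/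

section

variable {V : Type*} {G : SimpleGraph V} {ℓ : V → Label} {A : Finset V}
  {p q v w x z x₁ x₂ y₁ z₁ : V}

lemma HasTwoNeighbors.isTwo (h : HasTwoNeighbors G A x p q) (hl : ℓ x = Label.free) :
    IsTwo G ℓ A x := ⟨h.mem, hl, h.degIn_eq⟩

/-- A free vertex `v` of degree at least 3 all of whose neighbours are free vertices of degree two
is reducible: force the vertices at distance two into the forest part, and put `v` into the
independent part. -/
lemma IsMinimal.not_forall_isTwo (h : IsMinimal G ℓ A) (hv : v ∈ A) (hl : ℓ v = Label.free)
    (hd : 3 ≤ degIn G v A) (hN : ∀ x ∈ A, G.Adj v x → IsTwo G ℓ A x) : False := by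
  obtain ⟨N, hNdef⟩ : ∃ N : Finset V, N = {x ∈ A | G.Adj v x} := ⟨_, rfl⟩
  have hNmem : ∀ x, x ∈ N ↔ x ∈ A ∧ G.Adj v x := by intro x; rw [hNdef]; simp
  have hNA : N ⊆ A := fun x hx => ((hNmem x).1 hx).1
  have hvN : v ∉ N := fun h' => G.loopless.irrefl _ ((hNmem v).1 h').2
  obtain ⟨B, hBdef⟩ : ∃ B, B = A \ insert v N := ⟨_, rfl⟩
  have hBmem : ∀ x, x ∈ B ↔ x ∈ A ∧ x ≠ v ∧ x ∉ N := by intro x; rw [hBdef]; simp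
  have hBA : B ⊂ A := hBdef ▸ sdiff_ssubset (insert_subset hv hNA) ⟨v, by simp⟩
  obtain ⟨Y, hYdef⟩ : ∃ Y : Finset V, Y = {y ∈ B | ∃ x ∈ N, G.Adj x y} := ⟨_, rfl⟩
  have hother : ∀ x ∈ N, ∃ y, HasTwoNeighbors G A x v y := fun x hx =>
    (hN x (hNA hx) ((hNmem x).1 hx).2).exists_neighbors hv ((hNmem x).1 hx).2.symm
  have hsp : IsSparse G (forced ℓ Y) B := by
    intro S hS hne
    have hSA : S ⊂ A := lt_of_le_of_lt hS hBA
    by_cases hc : #(S ∩ Y) ≤ 2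
    · exact h.one_le_potential_forced hSA hne hc
    -- The vertices of `N` with a neighbour in `S`.
    obtain ⟨X, hXdef⟩ : ∃ X : Finset V, X = {x ∈ N | ∃ y ∈ S, G.Adj x y} := ⟨_, rfl⟩
    have hXN : X ⊆ N := hXdef ▸ filter_subset _ _
    have hvS : v ∉ S := fun h' => ((hBmem v).1 (hS h')).2.1 rfl
    have hSN : ∀ x ∈ N, x ∉ S := fun x hx h' => ((hBmem x).1 (hS h')).2.2 hx
    have hX1 : #(S ∩ Y) ≤ #X := by
      have hsub : S ∩ Y ⊆ X.biUnion fun x => {y ∈ S | G.Adj x y} := by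
        intro y hy
        have hyS := (mem_inter.1 hy).1
        have hyY := (mem_inter.1 hy).2
        rw [hYdef, mem_filter] at hyY
        obtain ⟨-, x, hx, hxy⟩ := hyY
        rw [mem_biUnion]
        refine ⟨x, ?_, by simp [hyS, hxy]⟩
        rw [hXdef, mem_filter]
        exact ⟨hx, y, hyS, hxy⟩
      refine (card_le_card hsub).trans ((card_biUnion_le_card_mul X _ 1 fun x hx => ?_).trans
        (by simp))
      obtain ⟨y, hy⟩ := hother x (hXN hx)
      exact degIn_le_one (G := G) (p := y) fun u hu hxu => by
        rcases hy.eq_or_eq u (hSA.1 hu) hxu with rfl | rfl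
        · exact absurd hu hvS
        · rfl
    -- Adding `v` and `X` to `S` adds weight `5 + 5 |X|` and at least `2 |X|` edges.
    have hXS : Disjoint X (insert v S) := disjoint_left.2 fun x hx hx' => by
      rcases mem_insert.1 hx' with rfl | hx'
      · exact hvN (hXN hx)
      · exact hSN x (hXN hx) hx'
    have h1 := h.sparse (X ∪ insert v S) (union_subset (hXN.trans hNA) (insert_subset hv hSA.1))
      ⟨v, by simp⟩
    rw [potential_union G ℓ hXS, potential_insert G ℓ hvS, hl] at h1
    have h2 : potential G ℓ X ≤ 5 * #X := by
      have : ∑ x ∈ X, (ℓ x).weight ≤ ∑ x ∈ X, 5 := sum_le_sum fun x _ => (ℓ x).weight_le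
      simp only [sum_const, nsmul_eq_mul] at this
      unfold potential
      omega
    have h3 : (2 * #X : ℤ) ≤ ∑ x ∈ X, (degIn G x (insert v S) : ℤ) := by
      rw [mul_comm, ← nsmul_eq_mul, ← sum_const]
      refine sum_le_sum fun x hx => ?_
      have hxN := hXN hx
      rw [hXdef, mem_filter] at hx
      obtain ⟨-, y, hy, hxy⟩ := hx
      exact_mod_cast IFPartition.two_le_degIn (mem_insert_self v S) (mem_insert_of_mem hy)
        (by rintro rfl; exact hvS hy) ((hNmem x).1 hxN).2.symm hxy
    have h4 := potential_sub_le_forced G ℓ Y S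
    simp only [Label.weight] at h1
    omega
  obtain ⟨I, hI⟩ := h.exists_coloring _ _ _ (card_lt_card hBA) hsp
  obtain ⟨hI, hIY⟩ := hI.of_forced
  have c1 := hI.insert_indep (v := v) (by simp [hBmem]) hl fun u hu hvu =>
    absurd ((hNmem u).2 ⟨hBA.1 hu, hvu⟩) ((hBmem u).1 hu).2.2
  -- The vertices of `N` go to the forest part one by one.
  have key : ∀ X ⊆ N, IsColoring G ℓ (X ∪ insert v B) (insert v I) := by
    intro X
    induction X using Finset.induction_on with
    | empty => intro _; simpa using c1
    | insert x X hxX ih =>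
      intro hX
      have hxN : x ∈ N := hX (mem_insert_self _ _)
      have hXN : X ⊆ N := (subset_insert _ _).trans hX
      obtain ⟨y, hy⟩ := hother x hxN
      have hxl : ℓ x ≠ Label.guarded := by
        rw [(hN x (hNA hxN) ((hNmem x).1 hxN).2).2.1]; simp
      rw [insert_union]
      refine (ih hXN).insert_two hy hxl (union_subset (hXN.trans hNA) (insert_subset hv hBA.1))
        ?_ ?_ (by simp)
      · simp only [mem_union, mem_insert, not_or]
        exact ⟨hxX, fun h' => hvN (h' ▸ hxN), fun h' => ((hBmem x).1 h').2.2 hxN⟩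
      · rintro ⟨-, hyI⟩
        rcases mem_insert.1 hyI with h' | h'
        · exact hy.ne h'.symm
        · refine hIY y ?_ h'
          rw [hYdef, mem_filter]
          exact ⟨hI.subset h', x, hxN, hy.right⟩
  exact h.elim (key N subset_rfl) (by
    intro u hu
    simp only [mem_union, mem_insert, hBmem]
    tauto)

/-- The neighbours of `v` in `A` are exactly the three vertices `p`, `q` and `r`. -/
structure HasThreeNeighbors (G : SimpleGraph V) (A : Finset V) (v p q r : V) : Prop where
  mem : v ∈ A
  mem₁ : p ∈ A
  mem₂ : q ∈ A
  mem₃ : r ∈ A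
  ne₁₂ : p ≠ q
  ne₁₃ : p ≠ r
  ne₂₃ : q ≠ r
  adj₁ : G.Adj v p
  adj₂ : G.Adj v q
  adj₃ : G.Adj v r
  eq_or : ∀ u ∈ A, G.Adj v u → u = p ∨ u = q ∨ u = r

lemma HasThreeNeighbors.swap₂₃ {r : V} (h : HasThreeNeighbors G A v p q r) :
    HasThreeNeighbors G A v p r q :=
  ⟨h.mem, h.mem₁, h.mem₃, h.mem₂, h.ne₁₃, h.ne₁₂, h.ne₂₃.symm, h.adj₁, h.adj₃, h.adj₂,
    fun u hu hvu => by have := h.eq_or u hu hvu; tauto⟩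

lemma HasThreeNeighbors.swap₁₂ {r : V} (h : HasThreeNeighbors G A v p q r) :
    HasThreeNeighbors G A v q p r :=
  ⟨h.mem, h.mem₂, h.mem₁, h.mem₃, h.ne₁₂.symm, h.ne₂₃, h.ne₁₃, h.adj₂, h.adj₁, h.adj₃,
    fun u hu hvu => by have := h.eq_or u hu hvu; tauto⟩

/-- Two adjacent free vertices of degree two with a common free neighbour `v` of degree 3 are
reducible. -/
lemma IsMinimal.not_triangle_of_free (h : IsMinimal G ℓ A) (hv : HasThreeNeighbors G A v x z w)
    (hl : ℓ v = Label.free) (hx : HasTwoNeighbors G A x v z) (hxl : ℓ x = Label.free)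
    (hz : HasTwoNeighbors G A z x v) (hzl : ℓ z = Label.free) : False := by
  have hvx := hv.adj₁.ne
  have hvz := hv.adj₂.ne
  have hvw := hv.adj₃.ne
  have hxz := hv.ne₁₂
  have hxw := hv.ne₁₃
  have hzw := hv.ne₂₃
  have hB : A \ {v, x, z} ⊂ A := sdiff_ssubset (by
    intro u hu
    simp only [mem_insert, mem_singleton] at hu
    rcases hu with rfl | rfl | rfl
    · exact hv.mem
    · exact hv.mem₁
    · exact hv.mem₂) ⟨v, by simp⟩
  obtain ⟨I, hI, hw⟩ := h.exists_coloring_forced hB (Y := {w}) (by simp)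
  have hvI : v ∉ I := fun h' => by simpa using hI.subset h'
  have hwI : w ∉ I := hw w (by simp)
  have c1 := hI.insert_forest (v := v) (p := w) (q := v) (by simp)
    (by rw [hl]; simp) (fun u hu hvu => by
      simp only [mem_sdiff, mem_insert, mem_singleton, not_or] at hu
      have := hv.eq_or u hu.1 hvu
      tauto) (by simp [hvI]) (.of_notMem_right (by simp))
  have c2 := c1.insert_indep (v := x) (by simp [hvx.symm]) hxl (fun u hu hxu => by
      simp only [mem_sdiff, mem_insert, mem_singleton, not_or] at hu
      obtain rfl : u = v := by
        rcases hu with rfl | hu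
        · rfl
        · have := hx.eq_or_eq u hu.1 hxu
          tauto
      refine ⟨hvI, by rw [hl]; simp, fun i hi hui => ?_⟩
      have h1 := hI.subset hi
      simp only [mem_sdiff, mem_insert, mem_singleton, not_or] at h1
      rcases hv.eq_or i h1.1 hui with rfl | rfl | rfl <;> tauto)
  have c3 := c2.insert_two hz (by rw [hzl]; simp)
    (insert_subset hx.mem (insert_subset hv.mem hB.1)) (by simp [hxz.symm, hvz.symm])
    (by simp [hvI, hvx]) (by simp)
  exact h.elim c3 (by intro u hu; simp only [mem_insert, mem_sdiff, mem_singleton]; tauto)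

/-- A free vertex `v` of degree 3 in a triangle `v x₂ w` with `x₂` of degree two, whose third
neighbour `x₁` starts a path of two free vertices of degree two, is reducible. -/
lemma IsMinimal.not_triangle_path (h : IsMinimal G ℓ A) (hv : HasThreeNeighbors G A v x₁ x₂ w)
    (hl : ℓ v = Label.free) (hx₁ : HasTwoNeighbors G A x₁ v z₁) (hx₁l : ℓ x₁ = Label.free)
    (hz₁ : HasTwoNeighbors G A z₁ x₁ y₁) (hz₁l : ℓ z₁ = Label.free)
    (hx₂ : HasTwoNeighbors G A x₂ v w) (hx₂l : ℓ x₂ = Label.free) (hz₁v : ¬ G.Adj z₁ v) :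
    False := by
  have hvx₁ := hv.adj₁.ne
  have hvx₂ := hv.adj₂.ne
  have hvw := hv.adj₃.ne
  have hx₁x₂ := hv.ne₁₂
  have hx₁w := hv.ne₁₃
  have hx₂w := hv.ne₂₃
  have hx₁z₁ := hx₁.right.ne
  have hvz₁ := hx₁.ne
  have hy₁v : y₁ ≠ v := by rintro rfl; exact hz₁v hz₁.right
  have hz₁x₂ : z₁ ≠ x₂ := by rintro rfl; exact hz₁v hv.adj₂.symm
  have hz₁w : z₁ ≠ w := by rintro rfl; exact hz₁v hv.adj₃.symm
  have hB : A \ {v, x₁, z₁, x₂} ⊂ A := sdiff_ssubset (by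
    intro u hu
    simp only [mem_insert, mem_singleton] at hu
    rcases hu with rfl | rfl | rfl | rfl
    · exact hv.mem
    · exact hv.mem₁
    · exact hz₁.mem
    · exact hv.mem₂) ⟨v, by simp⟩
  -- Adding `v` and `x₂` to a set that contains `w`.
  have hpot : ∀ S ⊆ A, w ∈ S → v ∉ S → x₂ ∉ S →
      potential G ℓ (insert x₂ (insert v S)) ≤ potential G ℓ S - 2 := by
    intro S hS hwS hvS hxS
    have h1 := potential_insert_le_one (ℓ := ℓ) hvS hwS hv.adj₃
    have h2 := potential_insert_le_two (ℓ := ℓ) (v := x₂) (S := insert v S)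
      (by simp [hxS, hvx₂.symm]) (mem_insert_self v S) (mem_insert_of_mem hwS) hvw
      hv.adj₂.symm hx₂.right
    rw [hl] at h1
    rw [hx₂l] at h2
    simp only [Label.weight] at h1 h2
    omega
  have hwl : ℓ w ≠ Label.guarded := by
    intro hwl
    have h1 := hpot {w} (by simpa using hv.mem₃) (by simp) (by simp [hvw]) (by simp [hx₂w])
    have h2 := h.sparse (insert x₂ (insert v {w})) (insert_subset hv.mem₂ (insert_subset hv.mem
      (by simpa using hv.mem₃))) ⟨x₂, mem_insert_self _ _⟩
    rw [potential_singleton, hwl] at h1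
    simp only [Label.weight] at h1
    omega
  have hsp : IsSparse G (Function.update ℓ w Label.guarded) (A \ {v, x₁, z₁, x₂}) := by
    intro S hS hne
    have hmem : ∀ u ∈ S, u ≠ v ∧ u ≠ x₁ ∧ u ≠ z₁ ∧ u ≠ x₂ := fun u hu => by
      have := hS hu
      simp only [mem_sdiff, mem_insert, mem_singleton, not_or] at this
      exact this.2
    have hSA : S ⊆ A := hS.trans sdiff_subset
    by_cases hwS : w ∈ S
    · have h1 := hpot S hSA hwS (fun h' => (hmem v h').1 rfl) (fun h' => (hmem x₂ h').2.2.2 rfl)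
      have h2 := h.three_le_potential_of_mem (x := x₂) (S := insert x₂ (insert v S))
        ((ssubset_iff_of_subset (insert_subset hv.mem₂ (insert_subset hv.mem hSA))).2
          ⟨x₁, hv.mem₁, fun h' => by
            simp only [mem_insert] at h'
            rcases h' with h' | h' | h'
            · exact hx₁x₂ h'
            · exact hvx₁ h'.symm
            · exact (hmem x₁ h').2.1 rfl⟩) (mem_insert_self _ _) (by rw [hx₂l]; simp)
      rw [potential_update_of_mem G ℓ hwS]
      have := (ℓ w).weight_le
      simp only [show Label.guarded.weight = 2 from rfl]
      omega
    · rw [potential_update_of_notMem G ℓ hwS]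
      exact h.sparse S hSA hne
  obtain ⟨I, hI'⟩ := h.exists_coloring _ _ _ (card_lt_card hB) hsp
  have hwB : w ∈ A \ {v, x₁, z₁, x₂} := by
    simp [hv.mem₃, hvw.symm, hx₁w.symm, hz₁w.symm, hx₂w.symm]
  have hwI : w ∉ I := fun h' => by simpa using hI'.free w h'
  have hwN := hI'.guarded w hwB (by simp)
  have hI : IsColoring G ℓ (A \ {v, x₁, z₁, x₂}) I := by
    refine hI'.weaken (fun _ _ _ _ h => h) (fun u _ hu => ?_) (fun u _ hu => ?_)
    · by_cases huw : u = w
      · subst huw; simp at hu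
      · rwa [Function.update_of_ne huw] at hu
    · by_cases huw : u = w
      · subst huw; simp
      · rwa [Function.update_of_ne huw]
  have hvI : v ∉ I := fun h' => by simpa using hI.subset h'
  have hx₁I : x₁ ∉ I := fun h' => by simpa using hI.subset h'
  have hz₁I : z₁ ∉ I := fun h' => by simpa using hI.subset h'
  have c1 := hI.insert_indep (v := v) (by simp) hl (fun u hu hvu => by
    simp only [mem_sdiff, mem_insert, mem_singleton, not_or] at hu
    obtain rfl : u = w := by
      have := hv.eq_or u hu.1 hvu
      tauto
    exact ⟨hwI, hwl, hwN⟩)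
  have c2 := c1.insert_two hx₂ (by rw [hx₂l]; simp) (insert_subset hv.mem hB.1)
    (by simp [hvx₂.symm]) (by simp [hwI, hvw.symm]) (by simp)
  have c3 := c2.insert_two hz₁ (by rw [hz₁l]; simp)
    (insert_subset hv.mem₂ (insert_subset hv.mem hB.1)) (by simp [hz₁x₂, hvz₁.symm])
    (by simp [hx₁I, hvx₁.symm]) (by simp [hvx₁.symm, hx₁x₂])
  have c4 := c3.insert_two hx₁ (by rw [hx₁l]; simp)
    (insert_subset hz₁.mem (insert_subset hv.mem₂ (insert_subset hv.mem hB.1)))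
    (by simp [hx₁z₁, hx₁x₂, hvx₁.symm]) (by simp [hz₁I, hvz₁.symm]) (by simp)
  exact h.elim c4 (by intro u hu; simp only [mem_insert, mem_sdiff, mem_singleton]; tauto)

end

/-! ### Contracting edges at vertices of degree three -/

section

variable {V : Type*} {G : SimpleGraph V} {ℓ : V → Label} {A B I : Finset V}
  {f v w x y z x₁ x₂ x₃ y₁ y₂ y₃ z₁ z₂ : V}

/-- A free vertex `v` of degree 3 is reducible if one neighbour `x₁` starts a path `x₁ z₁` of two
free vertices of degree two, and another neighbour `x₂` is free of degree two. Apart from the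
triangles treated above, the path is deleted and `v` is contracted into its third neighbour `w`,
which is forced into the forest part. -/
lemma IsMinimal.not_path_and_two (h : IsMinimal G ℓ A) (hv : HasThreeNeighbors G A v x₁ x₂ w)
    (hl : ℓ v = Label.free) (hx₁ : HasTwoNeighbors G A x₁ v z₁) (hx₁l : ℓ x₁ = Label.free)
    (hz₁ : HasTwoNeighbors G A z₁ x₁ y₁) (hz₁l : ℓ z₁ = Label.free)
    (hx₂ : HasTwoNeighbors G A x₂ v y₂) (hx₂l : ℓ x₂ = Label.free) : False := by
  have hvx₁ := hv.adj₁.ne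
  have hvx₂ := hv.adj₂.ne
  have hvw := hv.adj₃.ne
  have hx₁x₂ := hv.ne₁₂
  have hx₁w := hv.ne₁₃
  have hx₂w := hv.ne₂₃
  have hx₁z₁ := hx₁.right.ne
  have hvz₁ := hx₁.ne
  have hy₁x₁ := hz₁.ne.symm
  by_cases hz₁v : G.Adj z₁ v
  · obtain rfl : v = y₁ := (hz₁.eq_or_eq v hv.mem hz₁v).resolve_left hvx₁
    rcases hv.eq_or z₁ hz₁.mem hz₁v.symm with rfl | rfl | rfl
    · exact hx₁z₁ rfl
    · exact h.not_triangle_of_free hv hl hx₁ hx₁l hz₁ hz₁l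
    · exact h.not_triangle_of_free hv.swap₂₃ hl hx₁ hx₁l hz₁ hz₁l
  by_cases hx₂w' : G.Adj x₂ w
  · obtain rfl : w = y₂ := (hx₂.eq_or_eq w hv.mem₃ hx₂w').resolve_left hvw.symm
    exact h.not_triangle_path hv hl hx₁ hx₁l hz₁ hz₁l hx₂ hx₂l hz₁v
  have hy₁v : y₁ ≠ v := by rintro rfl; exact hz₁v hz₁.right
  have hz₁x₂ : z₁ ≠ x₂ := by rintro rfl; exact hz₁v hv.adj₂.symm
  have hz₁w : z₁ ≠ w := by rintro rfl; exact hz₁v hv.adj₃.symm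
  have hwx₂' : ¬ G.Adj w x₂ := fun h' => hx₂w' h'.symm
  obtain ⟨B, hBdef⟩ : ∃ B, B = A \ {v, x₁, z₁} := ⟨_, rfl⟩
  have hBmem : ∀ u, u ∈ B ↔ u ∈ A ∧ u ≠ v ∧ u ≠ x₁ ∧ u ≠ z₁ := by
    intro u; rw [hBdef]; simp
  have hB : B ⊂ A := hBdef ▸ sdiff_ssubset (by
    intro u hu
    simp only [mem_insert, mem_singleton] at hu
    rcases hu with rfl | rfl | rfl
    · exact hv.mem
    · exact hv.mem₁
    · exact hz₁.mem) ⟨v, by simp⟩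
  have hsp : IsSparse (G ⊔ SimpleGraph.edge w x₂) (forced ℓ {w}) B := by
    intro S hS hne
    have hSA : S ⊂ A := lt_of_le_of_lt hS hB
    have hmem : ∀ u ∈ S, u ≠ v ∧ u ≠ x₁ ∧ u ≠ z₁ := fun u hu => ((hBmem u).1 (hS hu)).2
    have hvS : v ∉ S := fun h' => (hmem v h').1 rfl
    have hx₁S : x₁ ∉ S := fun h' => (hmem x₁ h').2.1 rfl
    have hz₁S : z₁ ∉ S := fun h' => (hmem z₁ h').2.2 rfl
    have hY : #(S ∩ {w}) ≤ 1 :=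
      (card_le_card inter_subset_right).trans (card_singleton w).le
    by_cases hwx : w ∈ S ∧ x₂ ∈ S
    · rw [potential_sup_edge _ _ hwx.1 hwx.2 hx₂w.symm hwx₂']
      have h1 := potential_sub_le_forced G ℓ {w} S
      have h2 := potential_insert_le_two (ℓ := ℓ) hvS hwx.1 hwx.2 hx₂w.symm hv.adj₃ hv.adj₂
      have hvl : (ℓ v).weight = 5 := by rw [hl]; rfl
      by_cases hy₁S : y₁ ∈ S
      · have h3 := potential_insert_le_one (ℓ := ℓ) hz₁S hy₁S hz₁.right
        have h4 : potential G ℓ (insert v (insert z₁ S)) ≤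
            potential G ℓ (insert z₁ S) + (ℓ v).weight - 8 :=
          potential_insert_le_two (by simp [hvS, hvz₁]) (mem_insert_of_mem hwx.1)
            (mem_insert_of_mem hwx.2) hx₂w.symm hv.adj₃ hv.adj₂
        have h5 : potential G ℓ (insert x₁ (insert v (insert z₁ S))) ≤
            potential G ℓ (insert v (insert z₁ S)) + (ℓ x₁).weight - 8 :=
          potential_insert_le_two (by simp [hx₁S, hvx₁.symm, hx₁z₁])
            (mem_insert_self _ _) (by simp) hvz₁ hx₁.left hx₁.right
        have h6 := h.sparse (insert x₁ (insert v (insert z₁ S))) (insert_subset hx₁.mem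
          (insert_subset hv.mem (insert_subset hz₁.mem hSA.1))) ⟨v, by simp⟩
        have hz₁w : (ℓ z₁).weight = 5 := by rw [hz₁l]; rfl
        have hx₁w : (ℓ x₁).weight = 5 := by rw [hx₁l]; rfl
        omega
      · have h3 := h.three_le_potential_of_mem (x := v) (S := insert v S)
          ((ssubset_iff_of_subset (insert_subset hv.mem hSA.1)).2
            ⟨x₁, hv.mem₁, by simp [hvx₁.symm, hx₁S]⟩) (mem_insert_self _ _) (by rw [hl]; simp)
        omega
    · rw [potential_sup_edge_of_notMem _ _ (by tauto)]
      exact h.one_le_potential_forced hSA hne (by omega)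
  obtain ⟨I, hI'⟩ := h.exists_coloring _ _ _ (card_lt_card hB) hsp
  obtain ⟨hI', hwI⟩ := hI'.of_forced
  replace hwI : w ∉ I := hwI w (by simp)
  have hadj : (G ⊔ SimpleGraph.edge w x₂).Adj w x₂ :=
    Or.inr (by simp [SimpleGraph.edge_adj, hx₂w.symm])
  have hI : IsColoring G ℓ B I :=
    hI'.weaken (fun x _ y _ h => Or.inl h) (fun _ _ h => h) fun _ _ h => h
  have hwB : w ∈ B := (hBmem w).2 ⟨hv.mem₃, hvw.symm, hx₁w.symm, hz₁w.symm⟩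
  have hvB : v ∉ B := by simp [hBmem]
  have hx₁B : x₁ ∉ B := by simp [hBmem]
  have hz₁B : z₁ ∉ B := by simp [hBmem]
  have hvI : v ∉ I := fun h' => hvB (hI.subset h')
  have hx₁I : x₁ ∉ I := fun h' => hx₁B (hI.subset h')
  have hz₁I : z₁ ∉ I := fun h' => hz₁B (hI.subset h')
  by_cases hx₂I : x₂ ∈ I
  · -- Exchange `x₂` for `v` in the independent part.
    have hE : B.erase x₂ ⊆ A := (erase_subset _ _).trans hB.1
    have c1 := (hI.restrict_erase (v := x₂)).insert_indep (v := v) (by simp [hvB]) hl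
      (fun u hu hvu => by
        have huB := mem_of_mem_erase hu
        have hux₂ := ne_of_mem_erase hu
        obtain rfl : u = w := by
          have h1 := hv.eq_or u (hE hu) hvu
          have h2 := (hBmem u).1 huB
          tauto
        refine ⟨by simp [hwI], fun hg => hI'.guarded u hwB hg x₂ hx₂I hadj, fun i hi hui => ?_⟩
        exact ne_of_mem_erase hi
          (hI'.unique u hwB i (mem_of_mem_erase hi) x₂ hx₂I (Or.inl hui) hadj))
    have hy₂I : y₂ ∉ insert v (I.erase x₂) := by
      intro h'
      rcases mem_insert.1 h' with h' | h'
      · exact hx₂.ne h'.symm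
      · exact hI.indep x₂ hx₂I y₂ (mem_of_mem_erase h') hx₂.right
    have c2 := c1.insert_two hx₂ (by rw [hx₂l]; simp) (insert_subset hv.mem hE)
      (by simp [hvx₂.symm]) (by tauto) (by simp)
    have c3 := c2.insert_two hz₁ (by rw [hz₁l]; simp)
      (insert_subset hv.mem₂ (insert_subset hv.mem hE)) (by simp [hz₁x₂, hvz₁.symm, hz₁B])
      (by simp [hx₁I, hvx₁.symm]) (by simp [hvx₁.symm, hx₁x₂, hx₁B])
    have c4 := c3.insert_two hx₁ (by rw [hx₁l]; simp)
      (insert_subset hz₁.mem (insert_subset hv.mem₂ (insert_subset hv.mem hE)))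
      (by simp [hx₁z₁, hx₁x₂, hvx₁.symm, hx₁B]) (by simp [hz₁I, hvz₁.symm]) (by simp)
    exact h.elim c4 (by intro u hu; simp only [mem_insert, mem_erase, hBmem]; tauto)
  · -- The edge `w x₂` is subdivided by `v`, and the path `x₁ z₁` need not close a cycle: if its other
    -- end `y₁` is in the forest part, `x₁` is put into the independent part.
    have hsep := hI'.forest.isSeparated hx₂w.symm hwx₂'
    have c1 := hI.insert_forest (v := v) hvB (by rw [hl]; simp) (fun u hu hvu => by
      have h1 := hv.eq_or u (hB.1 hu) hvu
      have h2 := (hBmem u).1 hu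
      show u = w ∨ u = x₂
      tauto) (by simp [hwI]) hsep
    by_cases hy₁I : y₁ ∈ I
    · have c2 := c1.insert_two hx₁ (by rw [hx₁l]; simp) (insert_subset hv.mem hB.1)
        (by simp [hx₁B, hvx₁.symm]) (by simp [hvI]) (by simp [hvz₁.symm, hz₁B])
      have c3 := c2.insert_two hz₁ (by rw [hz₁l]; simp)
        (insert_subset hv.mem₁ (insert_subset hv.mem hB.1))
        (by simp [hz₁B, hvz₁.symm, hx₁z₁.symm]) (by simp [hx₁I]) (by simp [hy₁I])
      exact h.elim c3 (by intro u hu; simp only [mem_insert, hBmem]; tauto)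
    · have c2 := c1.insert_indep (v := x₁) (by simp [hx₁B, hvx₁.symm]) hx₁l (fun u hu hx₁u => by
        obtain rfl : u = v := by
          rcases mem_insert.1 hu with hu | hu
          · exact hu
          · have h1 := hx₁.eq_or_eq u (hB.1 hu) hx₁u
            have h2 := (hBmem u).1 hu
            tauto
        refine ⟨hvI, by rw [hl]; simp, fun i hi hui => ?_⟩
        have h1 := hI.subset hi
        rcases hv.eq_or i (hB.1 h1) hui with rfl | rfl | rfl <;> tauto)
      have c3 := c2.insert_two hz₁ (by rw [hz₁l]; simp)
        (insert_subset hv.mem₁ (insert_subset hv.mem hB.1))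
        (by simp [hz₁B, hvz₁.symm, hx₁z₁.symm]) (by simp [hy₁I, hy₁x₁]) (by simp)
      exact h.elim c3 (by intro u hu; simp only [mem_insert, hBmem]; tauto)

/-- A forest vertex of degree 3 whose neighbours are free of degree two is reducible if two of them
are adjacent. -/
lemma IsMinimal.not_triangle_of_forest (h : IsMinimal G ℓ A)
    (hf : HasThreeNeighbors G A f x z w) (hl : ℓ f = Label.forest)
    (hx : HasTwoNeighbors G A x f z) (hxl : ℓ x = Label.free)
    (hz : HasTwoNeighbors G A z x f) (hzl : ℓ z = Label.free)
    (hw : HasTwoNeighbors G A w f y) (hwl : ℓ w = Label.free) : False := by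
  have hfx := hf.adj₁.ne
  have hfz := hf.adj₂.ne
  have hfw := hf.adj₃.ne
  have hxz := hf.ne₁₂
  have hxw := hf.ne₁₃
  have hzw := hf.ne₂₃
  have hB : A \ {f, x, z, w} ⊂ A := sdiff_ssubset (by
    intro u hu
    simp only [mem_insert, mem_singleton] at hu
    rcases hu with rfl | rfl | rfl | rfl
    · exact hf.mem
    · exact hf.mem₁
    · exact hf.mem₂
    · exact hf.mem₃) ⟨f, by simp⟩
  obtain ⟨I, hI⟩ := h.coloring_of_ssubset hB
  have hfI : f ∉ I := fun h' => by simpa using hI.subset h'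
  have hxI : x ∉ I := fun h' => by simpa using hI.subset h'
  have hzI : z ∉ I := fun h' => by simpa using hI.subset h'
  have hwI : w ∉ I := fun h' => by simpa using hI.subset h'
  have c1 := hI.insert_two hw (by rw [hwl]; simp) hB.1 (by simp) (by simp [hfI]) (by simp)
  have c2 := c1.insert_forest (v := f) (p := w) (q := f) (by simp [hfw]) (by rw [hl]; simp)
    (fun u hu hfu => by
      simp only [mem_sdiff, mem_insert, mem_singleton, not_or] at hu
      rcases hu with rfl | hu
      · exact Or.inl rfl
      · have := hf.eq_or u hu.1 hfu
        tauto) (by simp [hwI]) (.of_notMem_right (by simp [hfw]))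
  have c3 := c2.insert_indep (v := x) (by simp [hfx.symm, hxw]) hxl (fun u hu hxu => by
    simp only [mem_sdiff, mem_insert, mem_singleton, not_or] at hu
    obtain rfl : u = f := by
      rcases hu with rfl | rfl | hu
      · rfl
      · rcases hx.eq_or_eq u hw.mem hxu with rfl | rfl <;> tauto
      · have := hx.eq_or_eq u hu.1 hxu
        tauto
    refine ⟨hfI, by rw [hl]; simp, fun i hi hui => ?_⟩
    rcases hf.eq_or i (hB.1 (hI.subset hi)) hui with rfl | rfl | rfl <;> tauto)
  have c4 := c3.insert_two hz (by rw [hzl]; simp)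
    (insert_subset hx.mem (insert_subset hf.mem (insert_subset hw.mem hB.1)))
    (by simp [hxz.symm, hfz.symm, hzw]) (by simp [hfI, hfx]) (by simp)
  exact h.elim c4 (by intro u hu; simp only [mem_insert, mem_sdiff, mem_singleton]; tauto)

/-- Let `f` be a forest vertex whose neighbour `x₂` starts a path `x₂ z₂` of two free vertices of
degree two. A coloring of everything but this path extends if the other neighbours of `f` are in
the forest part: unless the path ends in the independent part, `x₂` can be added to that part. -/
lemma IsMinimal.not_coloring_without_path {C : Finset V} (h : IsMinimal G ℓ A)
    (hf : HasThreeNeighbors G A f x₁ x₂ x₃) (hl : ℓ f = Label.forest)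
    (hx₂ : HasTwoNeighbors G A x₂ f z₂) (hx₂l : ℓ x₂ = Label.free)
    (hz₂ : HasTwoNeighbors G A z₂ x₂ y₂) (hz₂l : ℓ z₂ = Label.free)
    (hI : IsColoring G ℓ C I) (hC : ∀ u, u ∈ C ↔ u ∈ A ∧ u ≠ x₂ ∧ u ≠ z₂)
    (hx₁I : x₁ ∉ I) (hx₃I : x₃ ∉ I) (hfI : f ∉ I) : False := by
  have hl' : ℓ f ≠ Label.guarded := by rw [hl]; simp
  have hx₂l' : ℓ x₂ ≠ Label.guarded := by rw [hx₂l]; simp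
  have hz₂l' : ℓ z₂ ≠ Label.guarded := by rw [hz₂l]; simp
  have hx₂z₂ := hx₂.right.ne
  have hx₂y₂ := hz₂.ne
  have hCA : C ⊆ A := fun u hu => ((hC u).1 hu).1
  have hx₂C : x₂ ∉ C := by simp [hC]
  have hz₂C : z₂ ∉ C := by simp [hC]
  have hx₂I : x₂ ∉ I := fun h' => hx₂C (hI.subset h')
  by_cases hy₂I : y₂ ∈ I
  · have c1 := hI.insert_two hx₂ hx₂l' hCA hx₂C (by simp [hfI]) (by simp [hz₂C])
    have c2 := c1.insert_two hz₂ hz₂l' (insert_subset hx₂.mem hCA) (by simp [hz₂C, hx₂z₂.symm])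
      (by simp [hx₂I]) (by simp [hy₂I])
    exact h.elim c2 (by intro u hu; simp only [mem_insert, hC]; tauto)
  · have c1 := hI.insert_indep hx₂C hx₂l (fun u hu hx₂u => by
      obtain rfl : u = f := by
        have h1 := (hC u).1 hu
        have h2 := hx₂.eq_or_eq u h1.1 hx₂u
        tauto
      refine ⟨hfI, hl', fun i hi hui => ?_⟩
      rcases hf.eq_or i (hCA (hI.subset hi)) hui with rfl | rfl | rfl <;> tauto)
    have c2 := c1.insert_two hz₂ hz₂l' (insert_subset hx₂.mem hCA) (by simp [hz₂C, hx₂z₂.symm])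
      (by simp [hy₂I, hx₂y₂.symm]) (by simp)
    exact h.elim c2 (by intro u hu; simp only [mem_insert, hC]; tauto)

/-- Contracting the edges `f x₁` and `f x₃` at a forest vertex `f` of degree 3, and deleting `x₂`,
keeps the graph sparse. -/
lemma IsMinimal.isSparse_contract (h : IsMinimal G ℓ A)
    (hf : HasThreeNeighbors G A f x₁ x₂ x₃) (hl' : ℓ f ≠ Label.guarded)
    (hx₁ : HasTwoNeighbors G A x₁ f z₁) (hx₁l : ℓ x₁ = Label.free)
    (hx₃ : HasTwoNeighbors G A x₃ f y₃) (hx₃l : ℓ x₃ = Label.free)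
    (hfz₁' : ¬ G.Adj f z₁) (hfy₃' : ¬ (G ⊔ SimpleGraph.edge f z₁).Adj f y₃) (hB : B ⊂ A)
    (hx₁B : x₁ ∉ B) (hx₂B : x₂ ∉ B) (hx₃B : x₃ ∉ B) :
    IsSparse (G ⊔ SimpleGraph.edge f z₁ ⊔ SimpleGraph.edge f y₃) ℓ B := by
  have hx₁x₂ := hf.ne₁₂
  have hx₁x₃ := hf.ne₁₃
  have hx₂x₃ := hf.ne₂₃
  have hfz₁ := hx₁.ne
  have hfy₃ := hx₃.ne
  intro S hS hne
  have hSA : S ⊂ A := lt_of_le_of_lt hS hB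
  have hx₁S : x₁ ∉ S := fun h' => hx₁B (hS h')
  have hx₂S : x₂ ∉ S := fun h' => hx₂B (hS h')
  have hx₃S : x₃ ∉ S := fun h' => hx₃B (hS h')
  have hx₁5 : (ℓ x₁).weight = 5 := by rw [hx₁l]; rfl
  have hx₃5 : (ℓ x₃).weight = 5 := by rw [hx₃l]; rfl
  have h0 := h.sparse S hSA.1 hne
  by_cases hfS : f ∈ S
  · by_cases hzS : z₁ ∈ S
    · have h1 := potential_insert_le_two (ℓ := ℓ) hx₁S hfS hzS hfz₁ hx₁.left hx₁.right
      by_cases hyS : y₃ ∈ S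
      · rw [potential_sup_edge _ _ hfS hyS hfy₃ hfy₃',
          potential_sup_edge _ _ hfS hzS hfz₁ hfz₁']
        have h2 := potential_insert_le_two (ℓ := ℓ) (v := x₃) (S := insert x₁ S)
          (by simp [hx₃S, hx₁x₃.symm])
          (mem_insert_of_mem hfS) (mem_insert_of_mem hyS) hfy₃ hx₃.left hx₃.right
        have h3 := h.three_le_potential_of_mem (x := f) (S := insert x₃ (insert x₁ S))
          ((ssubset_iff_of_subset (insert_subset hx₃.mem (insert_subset hx₁.mem hSA.1))).2
            ⟨x₂, hf.mem₂, by simp [hx₂S, hx₂x₃, hx₁x₂.symm]⟩) (by simp [hfS]) hl'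
        omega
      · rw [potential_sup_edge_of_notMem _ _ (Or.inr hyS),
          potential_sup_edge _ _ hfS hzS hfz₁ hfz₁']
        have h3 := h.three_le_potential_of_mem (x := f) (S := insert x₁ S)
          ((ssubset_iff_of_subset (insert_subset hx₁.mem hSA.1)).2
            ⟨x₂, hf.mem₂, by simp [hx₂S, hx₁x₂.symm]⟩) (by simp [hfS]) hl'
        omega
    · by_cases hyS : y₃ ∈ S
      · rw [potential_sup_edge _ _ hfS hyS hfy₃ hfy₃',
          potential_sup_edge_of_notMem _ _ (Or.inr hzS)]
        have h2 := potential_insert_le_two (ℓ := ℓ) hx₃S hfS hyS hfy₃ hx₃.left hx₃.right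
        have h3 := h.three_le_potential_of_mem (x := f) (S := insert x₃ S)
          ((ssubset_iff_of_subset (insert_subset hx₃.mem hSA.1)).2
            ⟨x₂, hf.mem₂, by simp [hx₂S, hx₂x₃]⟩) (by simp [hfS]) hl'
        omega
      · rwa [potential_sup_edge_of_notMem _ _ (Or.inr hyS),
          potential_sup_edge_of_notMem _ _ (Or.inr hzS)]
  · rwa [potential_sup_edge_of_notMem _ _ (Or.inl hfS),
      potential_sup_edge_of_notMem _ _ (Or.inl hfS)]

/-- A forest vertex `f` of degree 3 whose neighbours `x₁, x₂, x₃` are free of degree two is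
reducible if `x₁` and `x₂` start paths `x₁ z₁` and `x₂ z₂` of two such vertices. The path `x₂ z₂` is
deleted and the edges `f x₁` and `f x₃` are contracted. -/
lemma IsMinimal.not_two_paths_and_two (h : IsMinimal G ℓ A)
    (hf : HasThreeNeighbors G A f x₁ x₂ x₃) (hl : ℓ f = Label.forest)
    (hx₁ : HasTwoNeighbors G A x₁ f z₁) (hx₁l : ℓ x₁ = Label.free)
    (hz₁ : HasTwoNeighbors G A z₁ x₁ y₁) (hz₁l : ℓ z₁ = Label.free)
    (hx₂ : HasTwoNeighbors G A x₂ f z₂) (hx₂l : ℓ x₂ = Label.free)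
    (hz₂ : HasTwoNeighbors G A z₂ x₂ y₂) (hz₂l : ℓ z₂ = Label.free)
    (hx₃ : HasTwoNeighbors G A x₃ f y₃) (hx₃l : ℓ x₃ = Label.free) : False := by
  have hfx₁ := hf.adj₁.ne
  have hfx₂ := hf.adj₂.ne
  have hfx₃ := hf.adj₃.ne
  have hx₁x₂ := hf.ne₁₂
  have hx₁x₃ := hf.ne₁₃
  have hx₂x₃ := hf.ne₂₃
  have hfz₁ := hx₁.ne
  have hfz₂ := hx₂.ne
  have hfy₃ := hx₃.ne
  have hx₁z₁ := hx₁.right.ne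
  have hx₃y₃ := hx₃.right.ne
  have hl' : ℓ f ≠ Label.guarded := by rw [hl]; simp
  have hx₁l' : ℓ x₁ ≠ Label.guarded := by rw [hx₁l]; simp
  have hx₃l' : ℓ x₃ ≠ Label.guarded := by rw [hx₃l]; simp
  have hz₁x₂ : z₁ ≠ x₂ := by
    rintro rfl
    obtain rfl : f = y₁ := (hz₁.eq_or_eq f hf.mem hx₂.left).resolve_left hfx₁
    exact h.not_triangle_of_forest hf hl hx₁ hx₁l hz₁ hx₂l hx₃ hx₃l
  have hz₁x₃ : z₁ ≠ x₃ := by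
    rintro rfl
    obtain rfl : f = y₁ := (hz₁.eq_or_eq f hf.mem hx₃.left).resolve_left hfx₁
    exact h.not_triangle_of_forest hf.swap₂₃ hl hx₁ hx₁l hz₁ hx₃l hx₂ hx₂l
  have hz₂x₁ : z₂ ≠ x₁ := by
    rintro rfl
    obtain rfl : f = y₂ := (hz₂.eq_or_eq f hf.mem hx₁.left).resolve_left hfx₂
    exact h.not_triangle_of_forest hf.swap₁₂ hl hx₂ hx₂l hz₂ hx₁l hx₃ hx₃l
  have hz₂x₃ : z₂ ≠ x₃ := by
    rintro rfl
    obtain rfl : f = y₂ := (hz₂.eq_or_eq f hf.mem hx₃.left).resolve_left hfx₂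
    exact h.not_triangle_of_forest hf.swap₁₂.swap₂₃ hl hx₂ hx₂l hz₂ hx₃l hx₁ hx₁l
  -- A common neighbour of two of the `xᵢ` would be the middle of a path of three vertices.
  have hz₁z₂ : z₁ ≠ z₂ := by
    rintro rfl
    obtain rfl : x₂ = y₁ := (hz₁.eq_or_eq x₂ hx₂.mem hz₂.left).resolve_left hx₁x₂.symm
    exact h.not_isTwo_path hz₁ hz₁l (hx₁.isTwo hx₁l) (hx₂.isTwo hx₂l)
  have hy₃z₁ : y₃ ≠ z₁ := by
    rintro rfl
    obtain rfl : x₃ = y₁ :=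
      (hz₁.eq_or_eq x₃ hx₃.mem hx₃.right.symm).resolve_left hx₁x₃.symm
    exact h.not_isTwo_path hz₁ hz₁l (hx₁.isTwo hx₁l) (hx₃.isTwo hx₃l)
  have hy₃z₂ : y₃ ≠ z₂ := by
    rintro rfl
    obtain rfl : x₃ = y₂ :=
      (hz₂.eq_or_eq x₃ hx₃.mem hx₃.right.symm).resolve_left hx₂x₃.symm
    exact h.not_isTwo_path hz₂ hz₂l (hx₂.isTwo hx₂l) (hx₃.isTwo hx₃l)
  have hy₃x₁ : y₃ ≠ x₁ := by
    rintro rfl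
    rcases hx₁.eq_or_eq x₃ hx₃.mem hx₃.right.symm with h' | h'
    · exact hfx₃ h'.symm
    · exact hz₁x₃ h'.symm
  have hy₃x₂ : y₃ ≠ x₂ := by
    rintro rfl
    rcases hx₂.eq_or_eq x₃ hx₃.mem hx₃.right.symm with h' | h'
    · exact hfx₃ h'.symm
    · exact hz₂x₃ h'.symm
  -- It is enough to color everything but `x₂` and `z₂`, with `x₁` and `x₃` in the forest part.
  suffices hsuff : ∃ C I, IsColoring G ℓ C I ∧ (∀ u, u ∈ C ↔ u ∈ A ∧ u ≠ x₂ ∧ u ≠ z₂) ∧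
      x₁ ∉ I ∧ x₃ ∉ I ∧ f ∉ I by
    obtain ⟨C, I, hI, hC, hx₁I, hx₃I, hfI⟩ := hsuff
    exact h.not_coloring_without_path hf hl hx₂ hx₂l hz₂ hz₂l hI hC hx₁I hx₃I hfI
  obtain ⟨B, hBdef⟩ : ∃ B, B = A \ {x₁, x₂, z₂, x₃} := ⟨_, rfl⟩
  have hBmem : ∀ u, u ∈ B ↔ u ∈ A ∧ u ≠ x₁ ∧ u ≠ x₂ ∧ u ≠ z₂ ∧ u ≠ x₃ := by
    intro u; rw [hBdef]; simp
  have hB : B ⊂ A := hBdef ▸ sdiff_ssubset (by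
    intro u hu
    simp only [mem_insert, mem_singleton] at hu
    rcases hu with rfl | rfl | rfl | rfl
    · exact hf.mem₁
    · exact hf.mem₂
    · exact hz₂.mem
    · exact hf.mem₃) ⟨x₁, by simp⟩
  have hfz₁' : ¬ G.Adj f z₁ := fun h' => by
    rcases hf.eq_or z₁ hz₁.mem h' with h' | h' | h'
    · exact hx₁z₁ h'.symm
    · exact hz₁x₂ h'
    · exact hz₁x₃ h'
  have hfy₃' : ¬ (G ⊔ SimpleGraph.edge f z₁).Adj f y₃ := by
    rintro (h' | h')
    · rcases hf.eq_or y₃ hx₃.right_mem h' with h' | h' | h'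
      · exact hy₃x₁ h'
      · exact hy₃x₂ h'
      · exact hx₃y₃ h'.symm
    · simp only [SimpleGraph.edge_adj] at h'
      tauto
  have hsp := h.isSparse_contract hf hl' hx₁ hx₁l hx₃ hx₃l hfz₁' hfy₃' hB (by simp [hBmem])
    (by simp [hBmem]) (by simp [hBmem])
  obtain ⟨I, hI'⟩ := h.exists_coloring _ _ _ (card_lt_card hB) hsp
  have hadjz : (G ⊔ SimpleGraph.edge f z₁ ⊔ SimpleGraph.edge f y₃).Adj f z₁ :=
    Or.inl (Or.inr (by simp [SimpleGraph.edge_adj, hfz₁]))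
  have hadjy : (G ⊔ SimpleGraph.edge f z₁ ⊔ SimpleGraph.edge f y₃).Adj f y₃ :=
    Or.inr (by simp [SimpleGraph.edge_adj, hfy₃])
  have hfB : f ∈ B := (hBmem f).2 ⟨hf.mem, hfx₁, hfx₂, hfz₂, hfx₃⟩
  have hfI : f ∉ I := fun h' => by
    have := hI'.free f h'
    rw [hl] at this; cases this
  have hx₁I : x₁ ∉ I := fun h' => ((hBmem x₁).1 (hI'.subset h')).2.1 rfl
  have hx₃I : x₃ ∉ I := fun h' => ((hBmem x₃).1 (hI'.subset h')).2.2.2.2 rfl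
  obtain ⟨D, hDdef⟩ : ∃ D, D = B.erase f := ⟨_, rfl⟩
  have hDmem : ∀ u, u ∈ D ↔ u ∈ A ∧ u ≠ f ∧ u ≠ x₁ ∧ u ≠ x₂ ∧ u ≠ z₂ ∧ u ≠ x₃ := by
    intro u; rw [hDdef, mem_erase, hBmem]; tauto
  have hDA : D ⊆ A := fun u hu => ((hDmem u).1 hu).1
  have hI : IsColoring G ℓ D I := by
    have h1 : IsColoring G ℓ B I :=
      hI'.weaken (fun x _ y _ h => Or.inl (Or.inl h)) (fun _ _ h => h) fun _ _ h => h
    have h2 := h1.restrict_erase (v := f)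
    rwa [erase_eq_of_notMem hfI, ← hDdef] at h2
  have hfD : f ∉ D := by simp [hDmem]
  have hx₁D : x₁ ∉ D := by simp [hDmem]
  have hx₃D : x₃ ∉ D := by simp [hDmem]
  have hx₁D' : insert x₁ D ⊆ A := insert_subset hx₁.mem hDA
  have hx₃D' : insert x₃ D ⊆ A := insert_subset hx₃.mem hDA
  -- The neighbours of `f` in `D ∪ {x₁, x₃}` are `x₁` and `x₃`.
  have hfN : ∀ u ∈ D, ¬ G.Adj f u := fun u hu hfu => by
    have h1 := (hDmem u).1 hu
    have h2 := hf.eq_or u h1.1 hfu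
    tauto
  by_cases hyI : y₃ ∈ I
  · have hzI : z₁ ∉ I := fun h' => hy₃z₁ (hI'.unique f hfB y₃ hyI z₁ h' hadjy hadjz)
    have c1 := hI.insert_two hx₁ hx₁l' hDA hx₁D (by simp [hfI]) (by simp [hfD])
    have c2 := c1.insert_forest (v := f) (p := x₁) (q := f) (by simp [hfx₁, hfD])
      (fun h' => absurd h' hl') (fun u hu hfu => by
        rcases mem_insert.1 hu with rfl | hu
        · exact Or.inl rfl
        · exact absurd hfu (hfN u hu)) (by simp [hfI])
      (.of_notMem_right (by simp [hfx₁, hfD]))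
    have c3 := c2.insert_two hx₃ hx₃l' (insert_subset hf.mem hx₁D')
      (by simp [hfx₃.symm, hx₁x₃.symm, hx₃D]) (by simp [hfI]) (by simp [hyI])
    refine ⟨_, I, c3, fun u => ?_, hx₁I, hx₃I, hfI⟩
    simp only [mem_insert, hDmem]
    constructor
    · rintro (rfl | rfl | rfl | hu)
      · exact ⟨hx₃.mem, hx₂x₃.symm, hz₂x₃.symm⟩
      · exact ⟨hf.mem, hfx₂, hfz₂⟩
      · exact ⟨hx₁.mem, hx₁x₂, hz₂x₁.symm⟩
      · tauto
    · tauto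
  have hCfinal : ∀ u, u ∈ insert f (insert x₃ (insert x₁ D)) ↔ u ∈ A ∧ u ≠ x₂ ∧ u ≠ z₂ := by
    intro u
    simp only [mem_insert, hDmem]
    constructor
    · rintro (rfl | rfl | rfl | hu)
      · exact ⟨hf.mem, hfx₂, hfz₂⟩
      · exact ⟨hx₃.mem, hx₂x₃.symm, hz₂x₃.symm⟩
      · exact ⟨hx₁.mem, hx₁x₂, hz₂x₁.symm⟩
      · tauto
    · tauto
  by_cases hzI : z₁ ∈ I
  · have c1 := hI.insert_two hx₃ hx₃l' hDA hx₃D (by simp [hfI]) (by simp [hfD])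
    have c2 := c1.insert_forest (v := f) (p := x₃) (q := f) (by simp [hfx₃, hfD])
      (fun h' => absurd h' hl') (fun u hu hfu => by
        rcases mem_insert.1 hu with rfl | hu
        · exact Or.inl rfl
        · exact absurd hfu (hfN u hu)) (by simp [hfI])
      (.of_notMem_right (by simp [hfx₃, hfD]))
    have c3 := c2.insert_two hx₁ hx₁l' (insert_subset hf.mem hx₃D')
      (by simp [hfx₁.symm, hx₁x₃, hx₁D]) (by simp [hfI]) (by simp [hzI])
    refine ⟨_, I, c3, fun u => ?_, hx₁I, hx₃I, hfI⟩
    rw [← hCfinal]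
    simp only [mem_insert]
    tauto
  · -- In the new graph `z₁ f y₃` is a path in the forest part, so that `z₁` and `y₃` are separated
    -- without `f`.
    have hsep : IsSeparated G (D \ I) z₁ y₃ := by
      intro T hT hzT hyT
      have hfT : f ∉ T := fun h' => hfD (mem_sdiff.1 (hT h')).1
      have h1 := hI'.forest (insert f T) (insert_subset (by simp [hfB, hfI]) (hT.trans
        (sdiff_subset_sdiff (hDdef ▸ erase_subset f B) subset_rfl))) ⟨f, mem_insert_self _ _⟩
      rw [degSum_insert _ hfT, card_insert_of_notMem hfT] at h1
      have h2 := IFPartition.two_le_degIn hzT hyT hy₃z₁.symm hadjz hadjy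
      have h3 : degSum G T ≤
          degSum (G ⊔ SimpleGraph.edge f z₁ ⊔ SimpleGraph.edge f y₃) T :=
        degSum_mono_graph fun x _ y _ h => Or.inl (Or.inl h)
      omega
    have c1 := hI.insert_two hx₁ hx₁l' hDA hx₁D (by simp [hfI]) (by simp [hfD])
    have c2 := c1.insert_two hx₃ hx₃l' hx₁D' (by simp [hx₃D, hx₁x₃.symm]) (by simp [hfI])
      (by simp [hfD, hfx₁])
    have hsep1 : IsSeparated G (insert x₁ D \ I) x₁ y₃ := by
      rw [insert_sdiff_of_notMem _ hx₁I]
      refine hsep.insert hI.forest (by simp [hx₁D]) hy₃x₁ fun u hu hx₁u => ?_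
      have h1 := (hDmem u).1 (mem_sdiff.1 hu).1
      have h2 := hx₁.eq_or_eq u h1.1 hx₁u
      tauto
    have hsep2 : IsSeparated G (insert x₃ (insert x₁ D) \ I) x₃ x₁ := by
      rw [insert_sdiff_of_notMem _ hx₃I]
      refine hsep1.symm.insert c1.forest (by simp [hx₃D, hx₁x₃.symm]) hx₁x₃ fun u hu hx₃u => ?_
      have h1 := (mem_sdiff.1 hu).1
      have h2 := hx₃.eq_or_eq u (hx₁D' h1) hx₃u
      rcases h2 with rfl | h2
      · simp [hfx₁, hfD] at h1
      · exact h2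
    have c3 := c2.insert_forest (v := f) (by simp [hfx₁, hfx₃, hfD]) (fun h' => absurd h' hl')
      (fun u hu hfu => by
        rcases mem_insert.1 hu with rfl | hu
        · exact Or.inl rfl
        rcases mem_insert.1 hu with rfl | hu
        · exact Or.inr rfl
        · exact absurd hfu (hfN u hu)) (by simp [hx₃I]) hsep2
    exact ⟨_, I, c3, hCfinal, hx₁I, hx₃I, hfI⟩

end

/-! ### Discharging -/

section

variable {V : Type*} {G : SimpleGraph V} {ℓ : V → Label} {A : Finset V} {v x : V}

/-- Twice the charge that the vertex `x` takes from each neighbour that is not itself a free vertex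
of degree two. Free vertices of degree two need a total charge of 1: those with a neighbour of the
same kind take 1 from their other neighbour, the remaining ones take 1/2 from both neighbours. -/
noncomputable def demand (G : SimpleGraph V) (ℓ : V → Label) (A : Finset V) (x : V) : ℕ :=
  if IsTwo G ℓ A x then if ∃ y, IsTwo G ℓ A y ∧ G.Adj x y then 2 else 1 else 0

lemma demand_le_two : demand G ℓ A x ≤ 2 := by
  unfold demand
  split_ifs <;> simp

lemma isTwo_of_demand_pos (h : 1 ≤ demand G ℓ A x) : IsTwo G ℓ A x := by
  unfold demand at h
  split_ifs at h <;> first | assumption | omega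

lemma exists_path_of_two_le_demand (hv : v ∈ A) (hvT : ¬ IsTwo G ℓ A v) (hvx : G.Adj v x)
    (h : 2 ≤ demand G ℓ A x) :
    ∃ z y, HasTwoNeighbors G A x v z ∧ HasTwoNeighbors G A z x y ∧ ℓ z = Label.free := by
  have hx := isTwo_of_demand_pos (by omega : 1 ≤ demand G ℓ A x)
  obtain ⟨z, hz⟩ := hx.exists_neighbors hv hvx.symm
  obtain ⟨u, hu, hxu⟩ : ∃ y, IsTwo G ℓ A y ∧ G.Adj x y := by
    unfold demand at h
    split_ifs at h with h1
    · exact h1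
    · omega
  obtain rfl : u = z := by
    rcases hz.eq_or_eq u hu.1 hxu with rfl | h'
    · exact absurd hu hvT
    · exact h'
  obtain ⟨y, hy⟩ := hu.exists_neighbors hz.mem hxu.symm
  exact ⟨u, y, hz, hy, hu.2.1⟩

lemma exists_hasThreeNeighbors (hv : v ∈ A) (h : degIn G v A = 3) :
    ∃ p q r, HasThreeNeighbors G A v p q r ∧ ({x ∈ A | G.Adj v x} : Finset V) = {p, q, r} := by
  obtain ⟨p, q, r, hpq, hpr, hqr, hS⟩ := card_eq_three.1 h
  have key : ∀ u, u ∈ A ∧ G.Adj v u ↔ u = p ∨ u = q ∨ u = r := fun u => by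
    have : u ∈ ({y ∈ A | G.Adj v y} : Finset V) ↔ u ∈ ({p, q, r} : Finset V) := by rw [hS]
    simpa using this
  have hp := (key p).2 (Or.inl rfl)
  have hq := (key q).2 (Or.inr (Or.inl rfl))
  have hr := (key r).2 (Or.inr (Or.inr rfl))
  exact ⟨p, q, r, ⟨hv, hp.1, hq.1, hr.1, hpq, hpr, hqr, hp.2, hq.2, hr.2,
    fun u hu hvu => (key u).1 ⟨hu, hvu⟩⟩, hS⟩

/-- A free vertex of degree two receives the charge it needs. -/
lemma IsMinimal.demand_mul_degIn (h : IsMinimal G ℓ A) (hx : IsTwo G ℓ A x) :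
    demand G ℓ A x * degIn G x {v ∈ A | ¬ IsTwo G ℓ A v} = 2 := by
  obtain ⟨p, q, hpq⟩ := exists_hasTwoNeighbors hx.1 hx.2.2
  have hsum : degIn G x {v ∈ A | IsTwo G ℓ A v} + degIn G x {v ∈ A | ¬ IsTwo G ℓ A v} = 2 := by
    rw [← degIn_union G x (disjoint_filter_filter_not A A _), filter_union_filter_not_eq, hx.2.2]
  have hle : degIn G x {v ∈ A | IsTwo G ℓ A v} ≤ 1 := by
    by_cases hp : IsTwo G ℓ A p
    · refine degIn_le_one (p := p) fun u hu hxu => ?_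
      rw [mem_filter] at hu
      rcases hpq.eq_or_eq u hu.1 hxu with rfl | rfl
      · rfl
      · exact (h.not_isTwo_path hpq hx.2.1 hp hu.2).elim
    · refine degIn_le_one (p := q) fun u hu hxu => ?_
      rw [mem_filter] at hu
      rcases hpq.eq_or_eq u hu.1 hxu with rfl | rfl
      · exact absurd hu.2 hp
      · rfl
  unfold demand
  rw [if_pos hx]
  split_ifs with hex
  · obtain ⟨y, hy, hxy⟩ := hex
    have := degIn_pos (S := {v ∈ A | IsTwo G ℓ A v}) (by simp [hy, hy.1]) hxy
    omega
  · have : degIn G x {v ∈ A | IsTwo G ℓ A v} = 0 :=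
      degIn_eq_zero.2 fun u hu hxu => hex ⟨u, (mem_filter.1 hu).2, hxu⟩
    omega

/-- The other vertices can afford what they give away. -/
lemma IsMinimal.sum_demand_le (h : IsMinimal G ℓ A) (hv : v ∈ A) (hvT : ¬ IsTwo G ℓ A v) :
    (∑ x ∈ A with G.Adj v x, demand G ℓ A x : ℤ) ≤ 4 * degIn G v A - 2 * (ℓ v).weight := by
  have hd := h.two_le_degIn hv
  have hbound : ∑ x ∈ A with G.Adj v x, demand G ℓ A x ≤ degIn G v A * 2 :=
    sum_le_card_nsmul _ _ 2 fun x _ => demand_le_two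
  rw [← Nat.cast_sum]
  rcases hl : ℓ v with _ | _ | _
  · -- A free vertex, of degree at least 3.
    have hd3 : 3 ≤ degIn G v A := by
      have : degIn G v A ≠ 2 := fun h' => hvT ⟨hv, hl, h'⟩
      omega
    obtain ⟨u, huA, hvu, huT⟩ : ∃ u ∈ A, G.Adj v u ∧ ¬ IsTwo G ℓ A u := by
      by_contra! hc
      exact h.not_forall_isTwo hv hl hd3 hc
    have hu0 : demand G ℓ A u = 0 := by unfold demand; rw [if_neg huT]
    -- The neighbour `u` takes nothing.
    have hbound' : ∑ x ∈ A with G.Adj v x, demand G ℓ A x ≤ (degIn G v A - 1) * 2 := by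
      have hmem : u ∈ ({x ∈ A | G.Adj v x} : Finset V) := by simp [huA, hvu]
      rw [← add_sum_erase _ _ hmem, hu0, zero_add, degIn, ← card_erase_of_mem hmem]
      exact sum_le_card_nsmul _ _ 2 fun x _ => demand_le_two
    rcases hd3.eq_or_lt with h3 | h4
    · obtain ⟨p, q, r, hN, hS⟩ := exists_hasThreeNeighbors hv h3.symm
      have key : ∀ p q r, HasThreeNeighbors G A v p q r →
            ¬ (2 ≤ demand G ℓ A p ∧ 1 ≤ demand G ℓ A q) := by
        rintro p q r hN ⟨hp, hq⟩
        obtain ⟨z, y, hz, hy, hzl⟩ := exists_path_of_two_le_demand hv hvT hN.adj₁ hp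
        have hp' := isTwo_of_demand_pos (by omega : 1 ≤ demand G ℓ A p)
        have hq' := isTwo_of_demand_pos hq
        obtain ⟨y', hy'⟩ := hq'.exists_neighbors hv hN.adj₂.symm
        exact h.not_path_and_two hN hl hz hp'.2.1 hy hzl hy' hq'.2.1
      have hsum : ∑ x ∈ A with G.Adj v x, demand G ℓ A x =
          demand G ℓ A p + demand G ℓ A q + demand G ℓ A r := by
        rw [hS, sum_insert (by simp [hN.ne₁₂, hN.ne₁₃]), sum_pair hN.ne₂₃, add_assoc]
      have k1 := key p q r hN
      have k2 := key p r q hN.swap₂₃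
      have k3 := key q p r hN.swap₁₂
      have k4 := key q r p hN.swap₁₂.swap₂₃
      have k5 := key r p q hN.swap₂₃.swap₁₂
      have k6 := key r q p hN.swap₂₃.swap₁₂.swap₂₃
      have hu' : demand G ℓ A p = 0 ∨ demand G ℓ A q = 0 ∨ demand G ℓ A r = 0 := by
        rcases hN.eq_or u huA hvu with rfl | rfl | rfl <;> simp [hu0]
      have b1 := demand_le_two (G := G) (ℓ := ℓ) (A := A) (x := p)
      have b2 := demand_le_two (G := G) (ℓ := ℓ) (A := A) (x := q)
      have b3 := demand_le_two (G := G) (ℓ := ℓ) (A := A) (x := r)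
      rw [hsum, show Label.free.weight = 5 from rfl]
      omega
    · rw [show Label.free.weight = 5 from rfl]
      omega
  · have hd3 := h.three_le_degIn hv hl
    rw [show Label.forest.weight = 4 from rfl]
    rcases hd3.eq_or_lt with h3 | h4
    · obtain ⟨p, q, r, hN, hS⟩ := exists_hasThreeNeighbors hv h3.symm
      have key : ∀ p q r, HasThreeNeighbors G A v p q r →
            ¬ (2 ≤ demand G ℓ A p ∧ 2 ≤ demand G ℓ A q ∧ 1 ≤ demand G ℓ A r) := by
        rintro p q r hN ⟨hp, hq, hr⟩
        obtain ⟨z, y, hz, hy, hzl⟩ := exists_path_of_two_le_demand hv hvT hN.adj₁ hp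
        obtain ⟨z', y', hz', hy', hzl'⟩ := exists_path_of_two_le_demand hv hvT hN.adj₂ hq
        have hp' := isTwo_of_demand_pos (by omega : 1 ≤ demand G ℓ A p)
        have hq' := isTwo_of_demand_pos (by omega : 1 ≤ demand G ℓ A q)
        have hr' := isTwo_of_demand_pos hr
        obtain ⟨y₃, hy₃⟩ := hr'.exists_neighbors hv hN.adj₃.symm
        exact h.not_two_paths_and_two hN hl hz hp'.2.1 hy hzl hz' hq'.2.1 hy' hzl' hy₃ hr'.2.1
      have hsum : ∑ x ∈ A with G.Adj v x, demand G ℓ A x =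
          demand G ℓ A p + demand G ℓ A q + demand G ℓ A r := by
        rw [hS, sum_insert (by simp [hN.ne₁₂, hN.ne₁₃]), sum_pair hN.ne₂₃, add_assoc]
      have k1 := key p q r hN
      have k2 := key p r q hN.swap₂₃
      have k3 := key q r p hN.swap₁₂.swap₂₃
      have b1 := demand_le_two (G := G) (ℓ := ℓ) (A := A) (x := p)
      have b2 := demand_le_two (G := G) (ℓ := ℓ) (A := A) (x := q)
      have b3 := demand_le_two (G := G) (ℓ := ℓ) (A := A) (x := r)
      rw [hsum]
      omega
    · omega
  · rw [show Label.guarded.weight = 2 from rfl]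
    omega

lemma not_isMinimal : ¬ IsMinimal G ℓ A := by
  intro h
  have hne : A.Nonempty := by
    rw [nonempty_iff_ne_empty]
    rintro rfl
    exact h.not_coloring ∅ (IsColoring.empty G ℓ)
  have hpos := h.sparse A subset_rfl hne
  have hgive := sum_le_sum fun v (hv : v ∈ ({v ∈ A | ¬ IsTwo G ℓ A v} : Finset V)) =>
    h.sum_demand_le (mem_filter.1 hv).1 (mem_filter.1 hv).2
  have hreceive : ∑ v ∈ A with ¬ IsTwo G ℓ A v, ∑ x ∈ A with G.Adj v x, (demand G ℓ A x : ℤ) =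
      2 * #{x ∈ A | IsTwo G ℓ A x} := by
    have h1 : ∀ x ∈ A, ∑ v ∈ A with ¬ IsTwo G ℓ A v, (if G.Adj v x then (demand G ℓ A x : ℤ) else 0)
        = if IsTwo G ℓ A x then 2 else 0 := by
      intro x _
      split_ifs with hx
      · have := h.demand_mul_degIn hx
        rw [degIn_eq_sum, mul_sum] at this
        simp only [mul_ite, mul_one, mul_zero, G.adj_comm x] at this
        exact_mod_cast this
      · refine sum_eq_zero fun v _ => ?_
        have : demand G ℓ A x = 0 := by unfold demand; rw [if_neg hx]
        simp [this]
    simp only [sum_filter (fun x => G.Adj _ x)]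
    rw [sum_comm, sum_congr rfl h1, ← sum_filter, sum_const, nsmul_eq_mul, mul_comm]
  have hpot : 2 * potential G ℓ A = 2 * #{x ∈ A | IsTwo G ℓ A x} -
      ∑ v ∈ A with ¬ IsTwo G ℓ A v, (4 * (degIn G v A : ℤ) - 2 * (ℓ v).weight) := by
    have h2 : 2 * potential G ℓ A = ∑ v ∈ A, (2 * (ℓ v).weight - 4 * (degIn G v A : ℤ)) := by
      unfold potential degSum
      rw [sum_sub_distrib, ← mul_sum, ← mul_sum]
      push_cast
      ring
    rw [h2, ← sum_filter_add_sum_filter_not A (IsTwo G ℓ A)]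
    have h3 : ∑ v ∈ A with IsTwo G ℓ A v, (2 * (ℓ v).weight - 4 * (degIn G v A : ℤ)) =
        2 * #{x ∈ A | IsTwo G ℓ A x} := by
      rw [sum_congr rfl fun v hv => show _ = (2 : ℤ) from ?_, sum_const, nsmul_eq_mul, mul_comm]
      rw [mem_filter] at hv
      rw [hv.2.2.1, hv.2.2.2]
      rfl
    rw [h3, sub_eq_add_neg, ← sum_neg_distrib]
    congr 1
    exact sum_congr rfl fun v _ => by ring
  omega

/-- Sparse labelled graphs have colorings. -/
theorem IsSparse.exists_coloring (h : IsSparse G ℓ A) : ∃ I, IsColoring G ℓ A I := by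
  induction hn : #A using Nat.strong_induction_on generalizing G ℓ A with
  | _ n ih =>
    by_contra! hc
    exact not_isMinimal ⟨h, hc, fun G' ℓ' A' hlt hsp => ih _ (hn ▸ hlt) hsp rfl⟩

end

/-! ### From colorings to I,F-partitions -/

section

variable {V : Type*} {G : SimpleGraph V} {ℓ : V → Label} {F I : Finset V}

lemma degSum_eq_card (G : SimpleGraph V) (S : Finset V) :
    degSum G S = #{e ∈ S ×ˢ S | G.Adj e.1 e.2} := by
  simp only [degSum, degIn_eq_sum, card_filter, sum_product]

lemma two_mul_ncard_edgeSet [Fintype V] (H : G.Subgraph) :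
    2 * H.edgeSet.ncard = #{e : V × V | H.Adj e.1 e.2} := by
  have := H.spanningCoe.two_mul_card_edgeFinset
  rw [← SimpleGraph.Subgraph.edgeSet_spanningCoe, ← SimpleGraph.coe_edgeFinset,
    Set.ncard_coe_finset, this]
  rfl

lemma two_mul_ncard_edgeSet_le [Fintype V] (H : G.Subgraph) :
    2 * H.edgeSet.ncard ≤ degSum G H.verts.toFinset := by
  rw [two_mul_ncard_edgeSet, degSum_eq_card]
  refine card_le_card fun e he => ?_
  simp only [mem_filter, mem_univ, true_and, mem_product, Set.mem_toFinset] at he ⊢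
  exact ⟨⟨he.fst_mem, he.snd_mem⟩, he.adj_sub⟩

lemma two_mul_ncard_edgeSet_induce [Fintype V] (S : Finset V) :
    2 * ((⊤ : G.Subgraph).induce (S : Set V)).edgeSet.ncard = degSum G S := by
  rw [two_mul_ncard_edgeSet, degSum_eq_card]
  congr 1
  ext e
  simp [and_assoc]

lemma bddAbove_averageDegrees [Finite V] (G : SimpleGraph V) :
    BddAbove {d : ℝ | ∃ H : G.Subgraph, H.verts.Nonempty ∧
      d = 2 * (H.edgeSet.ncard : ℝ) / (H.verts.ncard : ℝ)} := by
  refine ((Set.finite_range fun H : G.Subgraph =>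
    2 * (H.edgeSet.ncard : ℝ) / (H.verts.ncard : ℝ)).subset ?_).bddAbove
  rintro d ⟨H, -, rfl⟩
  exact ⟨H, rfl⟩

/-- Without precoloured vertices, sparsity is `Mad < 5/2`. -/
lemma isSparse_of_maxAvgDegree_lt [Fintype V] (h : G.maxAvgDegree < 5 / 2) :
    IsSparse G (fun _ => Label.free) univ := by
  intro S _ hne
  have hpos : (0 : ℝ) < #S := by exact_mod_cast hne.card_pos
  have h1 : 2 * (((⊤ : G.Subgraph).induce (S : Set V)).edgeSet.ncard : ℝ) / (#S : ℝ) < 5 / 2 := by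
    refine lt_of_le_of_lt (le_csSup (bddAbove_averageDegrees G)
      ⟨(⊤ : G.Subgraph).induce (S : Set V), by simpa using hne, ?_⟩) h
    simp
  have h2 : (2 * (((⊤ : G.Subgraph).induce (S : Set V)).edgeSet.ncard : ℝ)) = degSum G S := by
    exact_mod_cast two_mul_ncard_edgeSet_induce S
  rw [h2, div_lt_iff₀ hpos] at h1
  have h3 : 2 * (degSum G S : ℝ) < 5 * #S := by linarith
  have h4 : 2 * degSum G S < 5 * #S := by exact_mod_cast h3
  simp only [potential, Label.weight, sum_const, nsmul_eq_mul]
  omega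

/-- A cycle would have at least as many edges as vertices. -/
lemma IsForest.isAcyclic [Fintype V] (h : IsForest G F) : (G.induce (F : Set V)).IsAcyclic := by
  intro v c hc
  obtain ⟨T, hT⟩ : ∃ T : Finset V, T = c.support.toFinset.map (Function.Embedding.subtype _) :=
    ⟨_, rfl⟩
  have hmem : ∀ x, x ∈ T ↔ ∃ y ∈ c.support, (y : V) = x := by
    intro x; rw [hT]; simp
  have hTF : T ⊆ F := by
    intro x hx
    obtain ⟨y, -, rfl⟩ := (hmem x).1 hx
    exact y.2
  have h1 := h T hTF ⟨v, (hmem v).2 ⟨v, c.start_mem_support, rfl⟩⟩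
  have h2 : #T • 2 ≤ degSum G T := by
    refine card_nsmul_le_sum _ _ _ fun x hx => ?_
    obtain ⟨y, hy, rfl⟩ := (hmem x).1 hx
    have h3 := hc.ncard_neighborSet_toSubgraph_eq_two hy
    obtain ⟨a, b, hab, hS⟩ := Set.ncard_eq_two.1 h3
    have ha : c.toSubgraph.Adj y a := by
      rw [← SimpleGraph.Subgraph.mem_neighborSet, hS]; simp
    have hb : c.toSubgraph.Adj y b := by
      rw [← SimpleGraph.Subgraph.mem_neighborSet, hS]; simp
    refine two_le_degIn (y := (a : V)) (z := (b : V)) ((hmem _).2 ⟨a, ?_, rfl⟩)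
      ((hmem _).2 ⟨b, ?_, rfl⟩) (fun h' => hab (Subtype.ext h')) ha.adj_sub hb.adj_sub
    · exact (SimpleGraph.Walk.mem_verts_toSubgraph c).1 ha.snd_mem
    · exact (SimpleGraph.Walk.mem_verts_toSubgraph c).1 hb.snd_mem
  rw [smul_eq_mul] at h2
  omega

lemma IsColoring.hasIFPartition [Fintype V] (h : IsColoring G ℓ univ I) : G.HasIFPartition := by
  refine ⟨I, ((univ \ I : Finset V) : Set V), ?_, ?_, ?_, h.forest.isAcyclic⟩
  · ext x
    simp
  · rw [Finset.disjoint_coe]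
    exact disjoint_sdiff
  · intro x hx y hy hxy
    rw [SimpleGraph.two_lt_edist_iff]
    refine ⟨hxy, h.indep x hx y hy, Set.eq_empty_of_forall_notMem fun w hw => ?_⟩
    exact hxy (h.unique w (mem_univ w) x hx y hy hw.1.symm hw.2.symm)

theorem hasIFPartition_of_maxAvgDegree_lt [Finite V] (h : G.maxAvgDegree < 5 / 2) :
    G.HasIFPartition := by
  have := Fintype.ofFinite V
  obtain ⟨I, hI⟩ := (isSparse_of_maxAvgDegree_lt h).exists_coloring
  exact hI.hasIFPartition

end

/-! ### Sharpness -/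

section

/-- A central triangle `(0,0), (1,0), (2,0)`, each vertex `(i,0)` of which is joined to the vertex
`(i,1)` of a further triangle `(i,1), (i,2), (i,3)`. -/
def sharpGraph : SimpleGraph (ULift.{u} (Fin 3 × Fin 4)) where
  Adj x y := (x.down.1 ≠ y.down.1 ∧ x.down.2 = 0 ∧ y.down.2 = 0) ∨
    (x.down.1 = y.down.1 ∧ x.down.2 ≠ y.down.2 ∧ (x.down.2 = 0 → y.down.2 = 1) ∧
      (y.down.2 = 0 → x.down.2 = 1))
  symm := ⟨by
    rintro x y (⟨h1, h2, h3⟩ | ⟨h1, h2, h3, h4⟩)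
    · exact Or.inl ⟨h1.symm, h3, h2⟩
    · exact Or.inr ⟨h1.symm, h2.symm, h4, h3⟩⟩
  loopless := ⟨by
    rintro x (⟨h, -⟩ | ⟨-, h, -⟩) <;> exact h rfl⟩

/-- Sums over a vertex set `S`, through the indicator function `c` of `S`. -/
lemma sum_eq_sum_indicator {S : Finset (ULift.{u} (Fin 3 × Fin 4))} {c : Fin 3 → Fin 4 → ℕ}
    (hc : ∀ i j, c i j = if ⟨(i, j)⟩ ∈ S then 1 else 0) (f : ULift.{u} (Fin 3 × Fin 4) → ℕ) :
    ∑ x ∈ S, f x = ∑ i, ∑ j, c i j * f ⟨(i, j)⟩ :=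
  calc ∑ x ∈ S, f x = ∑ x, if x ∈ S then f x else 0 := by simp
    _ = ∑ p : Fin 3 × Fin 4, if ⟨p⟩ ∈ S then f ⟨p⟩ else 0 :=
      Fintype.sum_equiv Equiv.ulift _ _ fun _ => rfl
    _ = ∑ i, ∑ j, c i j * f ⟨(i, j)⟩ := by
      rw [Fintype.sum_prod_type]
      simp [hc]

lemma degSum_sharpGraph {S : Finset (ULift.{u} (Fin 3 × Fin 4))} {c : Fin 3 → Fin 4 → ℕ}
    (hc : ∀ i j, c i j = if ⟨(i, j)⟩ ∈ S then 1 else 0) :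
    degSum sharpGraph S = 2 * (c 0 0 * c 1 0 + c 1 0 * c 2 0 + c 0 0 * c 2 0) +
      ∑ i, 2 * (c i 0 * c i 1 + c i 1 * c i 2 + c i 1 * c i 3 + c i 2 * c i 3) := by
  simp only [degSum, degIn_eq_sum, sum_eq_sum_indicator hc, Fin.sum_univ_three, Fin.sum_univ_four]
  simp [sharpGraph]
  ring

lemma two_mul_degSum_sharpGraph_le (S : Finset (ULift.{u} (Fin 3 × Fin 4))) :
    2 * degSum sharpGraph S ≤ 5 * #S := by
  obtain ⟨c, hc⟩ : ∃ c : Fin 3 → Fin 4 → ℕ, ∀ i j, c i j = if ⟨(i, j)⟩ ∈ S then 1 else 0 :=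
    ⟨_, fun _ _ => rfl⟩
  have h01 : ∀ i j, c i j = 0 ∨ c i j = 1 := fun i j => by
    rw [hc]; split_ifs <;> simp
  -- Each outer part has weight 4 left for its vertex in the central triangle.
  have hpart : ∀ i, 4 * (c i 0 * c i 1 + c i 1 * c i 2 + c i 1 * c i 3 + c i 2 * c i 3) +
      4 * c i 0 ≤ 5 * (c i 0 + c i 1 + c i 2 + c i 3) := by
    intro i
    rcases h01 i 0 with h0 | h0 <;> rcases h01 i 1 with h1 | h1 <;>
    rcases h01 i 2 with h2 | h2 <;> rcases h01 i 3 with h3 | h3 <;>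
    simp [h0, h1, h2, h3]
  have hcentre : c 0 0 * c 1 0 + c 1 0 * c 2 0 + c 0 0 * c 2 0 ≤ c 0 0 + c 1 0 + c 2 0 := by
    rcases h01 0 0 with h0 | h0 <;> rcases h01 1 0 with h1 | h1 <;>
    rcases h01 2 0 with h2 | h2 <;> simp [h0, h1, h2]
  have hcard : #S = ∑ i, ∑ j, c i j := by
    rw [card_eq_sum_ones, sum_eq_sum_indicator hc]
    simp
  have p0 := hpart 0
  have p1 := hpart 1
  have p2 := hpart 2
  rw [hcard, degSum_sharpGraph hc]
  simp only [Fin.sum_univ_three, Fin.sum_univ_four]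
  linarith

/-- Three mutually adjacent vertices do not lie in a forest. -/
lemma false_of_triangle {V : Type*} {G : SimpleGraph V} {F : Set V}
    (hF : (G.induce F).IsAcyclic) {x y z : V} (hx : x ∈ F) (hy : y ∈ F) (hz : z ∈ F)
    (hxy : G.Adj x y) (hxz : G.Adj x z) (hyz : G.Adj y z) : False := by
  classical
  obtain ⟨u, c, hc, -⟩ := SimpleGraph.is3Clique_iff_exists_cycle_length_three.1
    ⟨({⟨x, hx⟩, ⟨y, hy⟩, ⟨z, hz⟩} : Finset F), SimpleGraph.is3Clique_triple_iff.2
      (show (G.induce F).Adj ⟨x, hx⟩ ⟨y, hy⟩ ∧ (G.induce F).Adj ⟨x, hx⟩ ⟨z, hz⟩ ∧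
        (G.induce F).Adj ⟨y, hy⟩ ⟨z, hz⟩ from ⟨hxy, hxz, hyz⟩)⟩
  exact hF c hc

/-- One of the vertices `(i,0)` is in the independent part; this forces the triangle
`(i,1), (i,2), (i,3)` into the forest part. -/
lemma not_hasIFPartition_sharpGraph : ¬ sharpGraph.{u}.HasIFPartition := by
  rintro ⟨I, F, hU, -, hI, hF⟩
  have hmem : ∀ x, x ∉ I → x ∈ F := fun x hx => by
    have : x ∈ I ∪ F := hU ▸ Set.mem_univ x
    exact this.resolve_left hx
  obtain ⟨i, hi⟩ : ∃ i : Fin 3, (⟨(i, 0)⟩ : ULift.{u} (Fin 3 × Fin 4)) ∈ I := by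
    by_contra! hc
    exact false_of_triangle hF (hmem _ (hc 0)) (hmem _ (hc 1)) (hmem _ (hc 2))
      (by simp [sharpGraph]) (by simp [sharpGraph]) (by simp [sharpGraph])
  have h01 : sharpGraph.{u}.Adj ⟨(i, 0)⟩ ⟨(i, 1)⟩ := by simp [sharpGraph]
  have h12 : sharpGraph.{u}.Adj ⟨(i, 1)⟩ ⟨(i, 2)⟩ := by simp [sharpGraph]
  have h13 : sharpGraph.{u}.Adj ⟨(i, 1)⟩ ⟨(i, 3)⟩ := by simp [sharpGraph]
  have h23 : sharpGraph.{u}.Adj ⟨(i, 2)⟩ ⟨(i, 3)⟩ := by simp [sharpGraph]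
  have key : ∀ j : Fin 4, j ≠ 0 → (⟨(i, j)⟩ : ULift.{u} (Fin 3 × Fin 4)) ∉ I := by
    intro j hj hjI
    have hne : (⟨(i, 0)⟩ : ULift.{u} (Fin 3 × Fin 4)) ≠ ⟨(i, j)⟩ := by simp [hj.symm]
    obtain ⟨-, hadj, hcommon⟩ := SimpleGraph.two_lt_edist_iff.1 (hI hi hjI hne)
    by_cases hj1 : j = 1
    · subst hj1
      exact hadj h01
    · refine Set.notMem_empty (⟨(i, 1)⟩ : ULift.{u} (Fin 3 × Fin 4)) (hcommon ▸ ⟨h01, ?_⟩)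
      simp [sharpGraph, hj, hj1]
  exact false_of_triangle hF (hmem _ (key 1 (by simp))) (hmem _ (key 2 (by simp)))
    (hmem _ (key 3 (by simp))) h12 h13 h23

lemma maxAvgDegree_sharpGraph : sharpGraph.{u}.maxAvgDegree = 5 / 2 := by
  classical
  refine le_antisymm (csSup_le ⟨_, ⊤, by simp, rfl⟩ ?_)
    (le_csSup (bddAbove_averageDegrees _)
      ⟨(⊤ : sharpGraph.Subgraph).induce
        ((univ : Finset (ULift.{u} (Fin 3 × Fin 4))) : Set (ULift.{u} (Fin 3 × Fin 4))), by simp, ?_⟩)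
  · rintro d ⟨H, hne, rfl⟩
    have h1 := two_mul_ncard_edgeSet_le H
    have h2 := two_mul_degSum_sharpGraph_le H.verts.toFinset
    have hpos : (0 : ℝ) < H.verts.ncard := by
      exact_mod_cast (Set.ncard_pos).2 hne
    rw [div_le_iff₀ hpos]
    rw [← Set.ncard_eq_toFinset_card'] at h2
    have h3 : 2 * (2 * H.edgeSet.ncard) ≤ 5 * H.verts.ncard := by omega
    have h4 : (2 * (2 * H.edgeSet.ncard) : ℝ) ≤ 5 * H.verts.ncard := by exact_mod_cast h3
    linarith
  · have h1 := two_mul_ncard_edgeSet_induce (G := sharpGraph.{u}) univ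
    rw [degSum_sharpGraph (c := fun _ _ => 1) (by simp)] at h1
    have h2 : (((⊤ : sharpGraph.{u}.Subgraph).induce
        ((univ : Finset (ULift.{u} (Fin 3 × Fin 4))) : Set (ULift.{u} (Fin 3 × Fin 4)))).edgeSet.ncard : ℝ) = 15 := by
      have h3 : ((⊤ : sharpGraph.{u}.Subgraph).induce
          ((univ : Finset (ULift.{u} (Fin 3 × Fin 4))) : Set (ULift.{u} (Fin 3 × Fin 4)))).edgeSet.ncard = 15 := by
        simp only [mul_one, sum_const, card_univ, Fintype.card_fin, smul_eq_mul] at h1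
        omega
      exact_mod_cast h3
    rw [h2]
    simp [Set.ncard_univ]
    norm_num

end

end IFPartition

theorem theorem2 :
    (∀ (V : Type u) [Finite V] (G : SimpleGraph V),
      G.maxAvgDegree < 5 / 2 → G.HasIFPartition) ∧
    (∃ (V : Type u) (_ : Finite V) (G : SimpleGraph V),
      G.maxAvgDegree = 5 / 2 ∧ ¬ G.HasIFPartition) ∧
    IsGreatest {b : ℝ | ∀ (V : Type u) [Finite V] (G : SimpleGraph V),
      G.maxAvgDegree < b → G.HasIFPartition} (5 / 2) := by
  have hsharp := IFPartition.maxAvgDegree_sharpGraph.{u}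
  have hnot := IFPartition.not_hasIFPartition_sharpGraph.{u}
  refine ⟨fun V _ G => IFPartition.hasIFPartition_of_maxAvgDegree_lt,
    ⟨_, inferInstance, _, hsharp, hnot⟩,
    fun V _ G => IFPartition.hasIFPartition_of_maxAvgDegree_lt, fun b hb => ?_⟩
  by_contra! hlt
  exact hnot (hb _ _ (hsharp ▸ hlt))
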